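/- **Setting.** Let $G$ be a countable discrete group equipped with a distance $d$, and let $\mu$ be a probability measure on $G$ with finite Shannon entropy whose support generates $G$ as a semigroup; put $\check\mu(g)=\mu(g^{-1})$. Let $\mathbb P_\mu$ be the law of the $\mu$-random walk $(\omega_n)$ started at $\omega_0=\mathrm{id}$, and let $\widetilde{\mathbb P}_\mu$ be the law on $G^{\mathbb Z}$ of the bilateral path $(\omega_n)_{n\in\mathbb Z}$ such that $(\omega_n)_{n\ge 0}$ has law $\mathbb P_\mu$, $(\omega_{-n})_{n\ge 0}$ has law $\mathbb P_{\check\mu}$, and these two are independent. Let $(X,\eta)$ be a standard Borel probability space with an ergodic measurable $G$-action preserving $\eta$, and let $x\mapsto L_x$ be a $G$-equivariant measurable map from $X$ to the space of subgroups of $G$ (so $L_{g.x}=gL_xg^{-1}$). Define $$\widetilde T(x,\omega)=\bigl(\omega_1^{-1}.x,\ (\omega_1^{-1}\omega_{n+1})_{n\in\mathbb Z}\bigr)\qquad\text{on } X\times G^{\mathbb Z}.$$ The $(G,\mu)$-Poisson bundle $(Z_+,\lambda_+)$ over $(X,\eta)$ is the point realization (a standard Borel probability $G$-space) of the $\sigma$-algebra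 of shift-invariant measurable sets of the space of coset trajectories $\bigsqcup_{x}\{x\}\times(L_x\backslash G)^{\mathbb N}$, equipped with the image of $\eta\times\mathbb P_\mu$ under $(x,\omega)\mapsto(x,(L_x\omega_n)_n)$; $(Z_-,\lambda_-)$ is the $(G,\check\mu)$-Poisson bundle over $(X,\eta)$. Let $(M_\pm,\bar\lambda_\pm)$ be intermediate $G$-factors $(Z_\pm,\lambda_\pm)\to(M_\pm,\bar\lambda_\pm)\to(X,\eta)$, the composition being the bundle projection, and let $(x,\omega)\mapsto\zeta_\pm(x,\omega)\in M_\pm$ be the resulting maps, which factor through $(x,(L_x\omega_{\pm n})_{n\ge 0})$. For $a\in L_x\backslash G$ let $|a|$ be the distance from the root $L_x$ to $a$ in the distance induced by $d$ on $L_x\backslash G$ (the infimum of the distances between representatives), and let $B_{L_x\backslash G}(R)=\{a:|a|\le R\}$. **Theorem (strip approximation for bundles over IRS).** Suppose that there is a measurable assignment of strips $$S(x,\omega)=S\bigl(x,\zeta_+(x,\omega),\zeta_-(x,\omega)\bigr)\subseteq L_x\backslash G$$ such that (i) compatibility: for every $n\ge 0$ and $\eta\times\widetilde{\mathbb P}_\mu$-a.e.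 $(x,\omega)$, the coset $L_x\omega_n$ belongs to $S(x,\omega)$ if and only if the root $L_{\omega_n^{-1}.x}=\omega_n^{-1}L_x\omega_n$ belongs to $S(\widetilde T^n(x,\omega))$; (ii) positive probability of containing the root: $(\eta\times\widetilde{\mathbb P}_\mu)(L_x\in S(x,\omega))>0$. Consider the condition of subexponential size in positive, respectively negative, time: (iii)$_\pm$ for every $\epsilon>0$ and $\eta\times\widetilde{\mathbb P}_\mu$-a.e. $(x,\omega)$, $$\limsup_{n\to+\infty}\frac1n\log\bigl|S(x,\omega)\cap B_{L_x\backslash G}(|L_x\omega_{\pm n}|)\bigr|\le\epsilon .$$ If (iii)$_+$ holds, then the factor map $(Z_+,\lambda_+)\to(M_+,\bar\lambda_+)$ is an isomorphism of measured $G$-spaces. If (iii)$_-$ holds, then the factor map $(Z_-,\lambda_-)\to(M_-,\bar\lambda_-)$ is an isomorphism of measured $G$-spaces. In particular, if both hold, then $(M_+,\bar\lambda_+)$ and $(M_-,\bar\lambda_-)$ are $G$-isomorphic to the Poisson bundles $(Z_+,\lambda_+)$ and $(Z_-,\lambda_-)$. -/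

import Mathlib

open MeasureTheory Filter Set

namespace PoissonBundle

noncomputable section

/-! ### Step distributions and path spaces -/

section Walks

variable {G : Type*} [Group G] [MeasurableSpace G]

/-- Finite Shannon entropy, `H(μ) = ∑ g, -μ(g) log μ(g) < ∞` (all the terms are nonnegative). -/
def FiniteEntropy (μ : Measure G) : Prop :=
  Summable fun g : G => Real.negMulLog (μ.real {g})

/-- The support of `μ` generates `G` as a semigroup. -/
def Nondegenerate (μ : Measure G) : Prop :=
  Subsemigroup.closure {g : G | μ {g} ≠ 0} = ⊤

/-- The trajectory with increments `s 0, s 1, …` that starts at the identity: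
`ω 0 = 1` and `ω n = s 0 * ⋯ * s (n - 1)`. -/
def walk (s : ℕ → G) : ℕ → G
  | 0 => 1
  | n + 1 => walk s n * s n

/-- The law of the trajectory of the `μ`-random walk started at the identity. Trajectories are
indexed by all of `ℕ`; the entry at time `0` is the identity almost surely. -/
def pathLaw (μ : Measure G) [IsProbabilityMeasure μ] : Measure (ℕ → G) :=
  (Measure.infinitePi fun _ : ℕ => μ).map walk

/-- The bilateral path with positive part `w` and negative part `v`. -/
def glue (p : (ℕ → G) × (ℕ → G)) : ℤ → G
  | Int.ofNat n => p.1 n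
  | Int.negSucc n => p.2 (n + 1)

/-- `(ω_n)_{n ≥ 0}`. -/
def posPart (ω : ℤ → G) : ℕ → G := fun n => ω n

/-- `(ω_{-n})_{n ≥ 0}`. -/
def negPart (ω : ℤ → G) : ℕ → G := fun n => ω (-(n : ℤ))

section Discrete

variable [Countable G] [DiscreteMeasurableSpace G]

theorem measurable_walk : Measurable (walk : (ℕ → G) → ℕ → G) := by
  refine measurable_pi_lambda _ fun n => ?_
  induction n with
  | zero => exact measurable_const
  | succ n ih =>
    have h : Measurable fun p : G × G => p.1 * p.2 := measurable_of_countable _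
    exact h.comp (ih.prodMk (measurable_pi_apply n))

set_option linter.unusedSectionVars false in
theorem measurable_glue : Measurable (glue : (ℕ → G) × (ℕ → G) → ℤ → G) := by
  refine measurable_pi_lambda _ fun n => ?_
  cases n with
  | ofNat n => exact (measurable_pi_apply n).comp measurable_fst
  | negSucc n => exact (measurable_pi_apply (n + 1)).comp measurable_snd

instance (μ : Measure G) [IsProbabilityMeasure μ] : IsProbabilityMeasure (pathLaw μ) :=
  Measure.isProbabilityMeasure_map measurable_walk.aemeasurable

/-- The reflected measure `g ↦ μ(g⁻¹)` is a probability measure. -/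
instance isProbabilityMeasure_inv (μ : Measure G) [IsProbabilityMeasure μ] :
    IsProbabilityMeasure μ.inv :=
  Measure.isProbabilityMeasure_map (measurable_of_countable _).aemeasurable

/-- The law of the bilateral path: the positive part is the `μ`-random walk and the negative part
is an independent random walk whose step distribution is the reflected measure. -/
def bilateralLaw (μ : Measure G) [IsProbabilityMeasure μ] : Measure (ℤ → G) :=
  ((pathLaw μ).prod (pathLaw μ.inv)).map glue

instance (μ : Measure G) [IsProbabilityMeasure μ] : IsProbabilityMeasure (bilateralLaw μ) :=
  Measure.isProbabilityMeasure_map measurable_glue.aemeasurable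

end Discrete

/-- The skew transformation
`(x, ω) ↦ (ω_1⁻¹ • x, (ω_1⁻¹ * ω_{n+1})_{n ∈ ℤ})`. -/
def skew {X : Type*} [MulAction G X] (y : X × (ℤ → G)) : X × (ℤ → G) :=
  ((y.2 1)⁻¹ • y.1, fun n => (y.2 1)⁻¹ * y.2 (n + 1))

end Walks

/-! ### Coset spaces -/

section Cosets

variable {G : Type*} [Group G]

/-- The space `L \ G` of cosets `L g`. -/
abbrev CosetSpace (L : Subgroup G) : Type _ := Quotient (QuotientGroup.rightRel L)

/-- The coset `L g`. -/
abbrev coset (L : Subgroup G) (g : G) : CosetSpace L := Quotient.mk (QuotientGroup.rightRel L) g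

/-- The distance on `L \ G` induced from the distance of `G`: the infimum of the distances
between representatives. -/
def cosetDist [MetricSpace G] (L : Subgroup G) (a b : CosetSpace L) : ℝ :=
  sInf {r : ℝ | ∃ g h : G, coset L g = a ∧ coset L h = b ∧ dist g h = r}

/-- The length `|a|` of `a ∈ L \ G`: the distance from the root `L` to `a`. -/
def cosetLength [MetricSpace G] (L : Subgroup G) (a : CosetSpace L) : ℝ :=
  cosetDist L (coset L 1) a

/-- The (closed) ball of radius `R` in `L \ G`, centred at the root `L`. -/
def cosetBall [MetricSpace G] (L : Subgroup G) (R : ℝ) : Set (CosetSpace L) :=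
  {a | cosetLength L a ≤ R}

end Cosets

/-! ### Factor maps and isomorphisms of `G`-spaces -/

section Factors

variable (G : Type*) [Group G] {A B : Type*} [MeasurableSpace A] [MeasurableSpace B]
  [MulAction G A] [MulAction G B]

/-- `f : (A, α) → (B, β)` is a `G`-factor map: measure preserving and equivariant a.e. -/
structure IsFactorMap (f : A → B) (α : Measure A) (β : Measure B) : Prop where
  measurePreserving : MeasurePreserving f α β
  equivariant : ∀ g : G, ∀ᵐ a ∂α, f (g • a) = g • f a

/-- `f : (A, α) → (B, β)` is an isomorphism of measured `G`-spaces: a `G`-factor map with an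
inverse, up to null sets, that is a `G`-factor map. -/
def IsIsomorphism (f : A → B) (α : Measure A) (β : Measure B) : Prop :=
  IsFactorMap G f α β ∧ ∃ r : B → A, IsFactorMap G r β α ∧
    (∀ᵐ a ∂α, r (f a) = a) ∧ (∀ᵐ b ∂β, f (r b) = b)

end Factors

/-! ### Poisson bundles -/

section Bundles

variable {G : Type*} [Group G] {X : Type*}

/-- A point of the space of coset trajectories
`W_Ω = ⨆ x, {x} × (L_x \ G)^ℕ`. -/
def CosetTraj (L : X → Subgroup G) : Type _ := Σ x : X, ℕ → CosetSpace (L x)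

/-- The map `(x, ω) ↦ (x, (L_x ω_n)_n)`. -/
def toCosetTraj (L : X → Subgroup G) (y : X × (ℕ → G)) : CosetTraj L :=
  ⟨y.1, fun n => coset (L y.1) (y.2 n)⟩

/-- The σ-algebra of the space of coset trajectories: `A` is measurable when its preimage in
`X × G^ℕ` is. -/
instance [MeasurableSpace G] [MeasurableSpace X] (L : X → Subgroup G) :
    MeasurableSpace (CosetTraj L) :=
  MeasurableSpace.map (toCosetTraj L) inferInstance

theorem measurable_toCosetTraj [MeasurableSpace G] [MeasurableSpace X] (L : X → Subgroup G) :
    Measurable (toCosetTraj L) := fun _ h => h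

/-- The time shift `(x, (L_x ω_n)_n) ↦ (x, (L_x ω_{n+1})_n)`. -/
def shift (L : X → Subgroup G) (c : CosetTraj L) : CosetTraj L := ⟨c.1, fun n => c.2 (n + 1)⟩

variable [MeasurableSpace G] [MeasurableSpace X]

/-- The law on coset trajectories: the image of `η × P_μ` (for a `G`-invariant `η`, this product
is the stationary joining of `η` with the path space). -/
def cosetTrajLaw (μ : Measure G) [IsProbabilityMeasure μ] (η : Measure X) (L : X → Subgroup G) :
    Measure (CosetTraj L) :=
  (η.prod (pathLaw μ)).map (toCosetTraj L)

/-- `x ↦ L_x` is a measurable `G`-equivariant map to the space of subgroups (`L_{g x} = g L_x g⁻¹`;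
the Borel σ-algebra of the Chabauty topology of a discrete group is generated by the
sets `{H | g ∈ H}`). -/
structure IsSubgroupMap [MulAction G X] (L : X → Subgroup G) : Prop where
  measurable : ∀ g : G, MeasurableSet {x : X | g ∈ L x}
  equivariant : ∀ (g : G) (x : X) (h : G), h ∈ L (g • x) ↔ g⁻¹ * h * g ∈ L x

/-- `(Z, lam)` is, through `θ : W_Ω → Z`, a point realization of the σ-algebra of shift invariant
sets of the space of coset trajectories, i.e. `(Z, lam)` is the `(G, μ)`-Poisson bundle over
the measure preserving system `(X, η)`. Here `G` acts on `W_Ω` by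
`g (x, (L_x ω_n)) = (g x, (L_{g x} g ω_n))`. -/
structure IsPoissonBundle [MulAction G X] (μ : Measure G) [IsProbabilityMeasure μ] (η : Measure X)
    (L : X → Subgroup G) {Z : Type*} [MeasurableSpace Z] [MulAction G Z] (lam : Measure Z)
    (θ : CosetTraj L → Z) : Prop where
  measurable_invariants : Measurable[MeasurableSpace.invariants (shift L)] θ
  map_eq : (cosetTrajLaw μ η L).map θ = lam
  equivariant : ∀ g : G, ∀ᵐ y ∂(η.prod (pathLaw μ)),
    θ (toCosetTraj L (g • y.1, fun n => g * y.2 n)) = g • θ (toCosetTraj L y)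
  generates : ∀ A : Set (CosetTraj L), MeasurableSet[MeasurableSpace.invariants (shift L)] A →
    ∃ B : Set Z, MeasurableSet B ∧ A =ᵐ[cosetTrajLaw μ η L] θ ⁻¹' B

/-- `(M, κ)` is an intermediate factor `(Z, lam) → (M, κ) → (X, η)` of the Poisson bundle: `p` and
`q` are `G`-factor maps whose composition is the projection of the bundle to its base. -/
structure IsIntermediate [MulAction G X] (μ : Measure G) [IsProbabilityMeasure μ] (η : Measure X)
    (L : X → Subgroup G) {Z : Type*} [MeasurableSpace Z] [MulAction G Z] (lam : Measure Z)
    (θ : CosetTraj L → Z) {M : Type*} [MeasurableSpace M] [MulAction G M] (κ : Measure M)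
    (p : Z → M) (q : M → X) : Prop where
  factor_left : IsFactorMap G p lam κ
  factor_right : IsFactorMap G q κ η
  proj : ∀ᵐ c ∂(cosetTrajLaw μ η L), q (p (θ c)) = c.1

/-- `ζ₊ : X × G^ℤ → M`, the map that factors through `(x, ω) ↦ (x, (L_x ω_n)_{n ≥ 0})`. -/
def zetaPos (L : X → Subgroup G) {Z M : Type*} (θ : CosetTraj L → Z) (p : Z → M)
    (y : X × (ℤ → G)) : M :=
  p (θ (toCosetTraj L (y.1, posPart y.2)))

/-- `ζ₋ : X × G^ℤ → M`, the map that factors through `(x, ω) ↦ (x, (L_x ω_{-n})_{n ≥ 0})`. -/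
def zetaNeg (L : X → Subgroup G) {Z M : Type*} (θ : CosetTraj L → Z) (p : Z → M)
    (y : X × (ℤ → G)) : M :=
  p (θ (toCosetTraj L (y.1, negPart y.2)))

/-- The strip `S(x, ω) = S(x, ζ₊(x, ω), ζ₋(x, ω))`, a subset of `L_x \ G`. -/
def stripAt {L : X → Subgroup G} {M₁ M₂ : Type*} (S : (x : X) → M₁ → M₂ → Set (CosetSpace (L x)))
    (ζ₁ : X × (ℤ → G) → M₁) (ζ₂ : X × (ℤ → G) → M₂) (y : X × (ℤ → G)) :
    Set (CosetSpace (L y.1)) :=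
  S y.1 (ζ₁ y) (ζ₂ y)

/-- `(1 / n) log |S ∩ B(|L_x g|)|` in `[-∞, ∞]`, with `log 0 = -∞` and `log ∞ = ∞`. -/
def stripGrowth [MetricSpace G] {L : X → Subgroup G} (x : X) (s : Set (CosetSpace (L x)))
    (g : G) (n : ℕ) : EReal :=
  ENNReal.log ((s ∩ cosetBall (L x) (cosetLength (L x) (coset (L x) g))).encard : ENNReal) /
    ((n : ℝ) : EReal)

end Bundles

end

end PoissonBundle

open PoissonBundle

/-! The proof compares two entropies. For a shift-invariant, equivariant image of the coset
trajectories (the Poisson bundle Z or its factor M), let Λ_g be the joint law of the base point and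
of the image of the trajectory started at g. Nondegeneracy makes all the Λ_g equivalent. The
densities ρ_g = dΛ_g/dΛ_1 form a multiplicative cocycle (`density_mul`), are harmonic in g
(`tsum_stepLaw_mul_density`) and depend only on the coset L_x g (`density_coset`). By the Markov
property, ρ_g times the mass of L_x g at time n is the conditional probability that L_x ω_n = L_x g,
given the base point and the image point. Along the path, log ρ at ω_n is a Birkhoff sum of a
function that is integrable because μ has finite entropy, over an ergodic transformation; let h(Z)
and h(M) be its means.

Equality case. The difference h(Z) - h(M) is nonnegative by Jensen's inequality, and if it is not
positive then the densities of Z are those of M pulled back (`density_eq_of_integral_le`,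
`density_eq`). A bounded function on Z minus its conditional expectation given M is then orthogonal
to every density, over every subset of the base. By the Markov property it is orthogonal to all
cylinders, so it vanishes (`exists_factor_of_density_eq`), and M determines Z.

Strips exclude h(Z) > h(M). Suppose that 0 < c < h(Z) - h(M). Conditional probabilities given Z are
at most 1, so those given M are eventually at most exp(-cn) along the path. The strip depends on the
point of M and on an independent half of the path, and it has at most exp(cn/2) cosets up to the
distance of L_x ω_n. Hence L_x ω_n lies in the strip with probability tending to 0. Compatibility
and the invariance of the bilateral shift bound this probability below by that of containing the
root, a contradiction.

Negative time is the same argument with the two halves exchanged. Compatibility is assumed along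
positive times only; `ae_biPoint_of_ae_walk` extends it to all group elements, hence to the negative
half. -/

set_option linter.unusedSectionVars false

/-! ### Increments of the walk and the Markov property -/

namespace PoissonBundle

open scoped ENNReal

section Increments

variable {G : Type*} [Group G] [MeasurableSpace G]

/-- The law of the increments of the `μ`-random walk. -/
noncomputable def incLaw (μ : Measure G) : Measure (ℕ → G) :=
  Measure.infinitePi fun _ : ℕ => μ

/-- The sequence `g, s 0, s 1, …`. -/
def consSeq (g : G) (s : ℕ → G) : ℕ → G
  | 0 => g
  | n + 1 => s n

/-- The sequence `s 1, s 2, …`. -/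
def tailSeq (s : ℕ → G) : ℕ → G := fun n => s (n + 1)

instance (μ : Measure G) [IsProbabilityMeasure μ] : IsProbabilityMeasure (incLaw μ) := by
  unfold incLaw; infer_instance

theorem measurable_consSeq : Measurable fun p : G × (ℕ → G) => consSeq p.1 p.2 := by
  refine measurable_pi_lambda _ fun n => ?_
  cases n with
  | zero => exact measurable_fst
  | succ n => exact (measurable_pi_apply n).comp measurable_snd

theorem measurable_tailSeq : Measurable (tailSeq : (ℕ → G) → ℕ → G) :=
  measurable_pi_lambda _ fun n => measurable_pi_apply (n + 1)

theorem map_consSeq (μ : Measure G) [IsProbabilityMeasure μ] :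
    (μ.prod (incLaw μ)).map (fun p => consSeq p.1 p.2) = incLaw μ := by
  classical
  refine Measure.eq_infinitePi _ fun s t ht => ?_
  obtain ⟨N, hN⟩ : ∃ N, s ⊆ Finset.range (N + 1) :=
    ⟨s.sup id, fun i hi => Finset.mem_range_succ_iff.2 (Finset.le_sup (f := id) hi)⟩
  -- Padding with `univ` replaces the index set `s` by an initial segment, whose coordinate 0 can be
  -- split off.
  set t' : ℕ → Set G := fun i => if i ∈ s then t i else univ with ht'
  have hmt' : ∀ i, MeasurableSet (t' i) := fun i => by
    simp only [ht']; split_ifs <;> simp [ht]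
  have h1 : (fun p : G × (ℕ → G) => consSeq p.1 p.2) ⁻¹' Set.pi s t =
      t' 0 ×ˢ Set.pi (Finset.range N) fun i => t' (i + 1) := by
    ext ⟨g, u⟩
    simp only [mem_preimage, Set.mem_pi, mem_prod, ht']
    constructor
    · intro h
      refine ⟨?_, fun i hi => ?_⟩
      · split_ifs with h0
        · exact h 0 h0
        · trivial
      · split_ifs with h0
        · exact h (i + 1) h0
        · trivial
    · rintro ⟨h0, h⟩ i hi
      have hi : i ∈ s := hi
      cases i with
      | zero => rw [if_pos hi] at h0; exact h0
      | succ i =>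
        have := Finset.mem_range.1 (hN hi)
        have := h i (by simp; omega)
        rw [if_pos hi] at this; exact this
  rw [Measure.map_apply measurable_consSeq (MeasurableSet.pi (Finset.countable_toSet s)
    fun i _ => ht i), h1, Measure.prod_prod, incLaw, Measure.infinitePi_pi _ fun i _ => hmt' _,
    mul_comm, ← Finset.prod_range_succ' (fun i => μ (t' i)),
    ← Finset.prod_subset hN]
  · exact Finset.prod_congr rfl fun i hi => by simp [ht', hi]
  · intro i _ hi
    simp [ht', hi]

theorem consSeq_head_tail (s : ℕ → G) : consSeq (s 0) (tailSeq s) = s := by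
  ext n; cases n <;> rfl

variable [Countable G] [DiscreteMeasurableSpace G]

theorem lintegral_incLaw_cons (μ : Measure G) [IsProbabilityMeasure μ] {F : G → (ℕ → G) → ℝ≥0∞}
    (hF : ∀ g, Measurable (F g)) :
    ∫⁻ s, F (s 0) (tailSeq s) ∂(incLaw μ) = ∑' g, μ {g} * ∫⁻ s, F g s ∂(incLaw μ) := by
  have hF' : Measurable fun p : G × (ℕ → G) => F p.1 p.2 :=
    measurable_from_prod_countable_right hF
  have h2 : Measurable fun s : ℕ → G => F (s 0) (tailSeq s) :=
    hF'.comp ((measurable_pi_apply 0).prodMk measurable_tailSeq)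
  have h3 : Measurable fun p : G × (ℕ → G) =>
      F (consSeq p.1 p.2 0) (tailSeq (consSeq p.1 p.2)) := hF'
  conv_lhs => rw [← map_consSeq μ]
  rw [lintegral_map h2 measurable_consSeq, lintegral_prod _ h3.aemeasurable, lintegral_countable']
  refine tsum_congr fun g => ?_
  rw [mul_comm]; rfl

/-- The law at time `n` of the `μ`-random walk. -/
noncomputable def stepLaw (μ : Measure G) (n : ℕ) : Measure G :=
  (incLaw μ).map fun s => walk s n

theorem walk_succ' (s : ℕ → G) (n : ℕ) : walk s (n + 1) = s 0 * walk (tailSeq s) n := by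
  induction n with
  | zero => simp [walk]
  | succ n ih => rw [walk, ih, walk, mul_assoc]; rfl

theorem measurable_walk_apply (n : ℕ) : Measurable fun s : ℕ → G => walk s n :=
  (measurable_pi_apply n).comp measurable_walk

theorem lintegral_stepLaw (μ : Measure G) [IsProbabilityMeasure μ] (n : ℕ) (f : G → ℝ≥0∞) :
    ∫⁻ s, f (walk s n) ∂(incLaw μ) = ∑' g, stepLaw μ n {g} * f g := by
  rw [← lintegral_map (f := f) (measurable_of_countable _) (measurable_walk_apply n),
    lintegral_countable']
  exact tsum_congr fun g => mul_comm _ _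

/-- The Markov property at time n: the position is independent of the later increments, which again
have law `incLaw μ`. -/
theorem lintegral_incLaw_split (μ : Measure G) [IsProbabilityMeasure μ] (n : ℕ)
    {F : G → (ℕ → G) → ℝ≥0∞} (hF : ∀ g, Measurable (F g)) :
    ∫⁻ s, F (walk s n) (tailSeq^[n] s) ∂(incLaw μ) =
      ∑' g, stepLaw μ n {g} * ∫⁻ s, F g s ∂(incLaw μ) := by
  induction n generalizing F with
  | zero =>
    have := lintegral_stepLaw μ 0 fun g => ∫⁻ s, F g s ∂(incLaw μ)
    rw [← this]
    simp [walk]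
  | succ n ih =>
    have h0 := lintegral_stepLaw μ (n + 1) fun g => ∫⁻ s, F g s ∂(incLaw μ)
    rw [← h0]
    simp only [walk_succ', Function.iterate_succ, Function.comp]
    rw [lintegral_incLaw_cons μ
      (F := fun g s => F (g * walk s n) (tailSeq^[n] s)),
      lintegral_incLaw_cons μ (F := fun g s => ∫⁻ u, F (g * walk s n) u ∂(incLaw μ))]
    · refine tsum_congr fun g => ?_
      rw [ih fun h => hF (g * h), ← lintegral_stepLaw μ n fun h => ∫⁻ s, F (g * h) s ∂(incLaw μ)]
    · intro g
      exact (measurable_of_countable fun h => ∫⁻ u, F (g * h) u ∂(incLaw μ)).comp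
        (measurable_walk_apply n)
    · intro g
      have : Measurable fun p : G × (ℕ → G) => F (g * p.1) p.2 :=
        measurable_from_prod_countable_right fun h => hF (g * h)
      exact this.comp ((measurable_walk_apply n).prodMk (measurable_tailSeq.iterate n))

theorem stepLaw_one (μ : Measure G) [IsProbabilityMeasure μ] : stepLaw μ 1 = μ := by
  have : (fun s : ℕ → G => walk s 1) = fun s => s 0 := by ext s; simp [walk]
  rw [stepLaw, this]
  exact (measurePreserving_eval_infinitePi (fun _ : ℕ => μ) 0).map_eq

theorem walk_add (s : ℕ → G) (m n : ℕ) : walk s (m + n) = walk s m * walk (tailSeq^[m] s) n := by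
  induction m generalizing s with
  | zero => simp [walk]
  | succ m ih => rw [Nat.succ_add, walk_succ', ih, walk_succ' s m, mul_assoc]; rfl

/-- One way to be at g * h at time m + n is to pass through g at time m. Keeping only this way
leaves a single term in each sum. -/
theorem stepLaw_mul_le (μ : Measure G) [IsProbabilityMeasure μ] (m n : ℕ) (g h : G) :
    stepLaw μ m {g} * stepLaw μ n {h} ≤ stepLaw μ (m + n) {g * h} := by
  classical
  have h1 := lintegral_stepLaw μ (m + n) (Set.indicator {g * h} 1)
  rw [tsum_eq_single (g * h) (by intro b hb; simp [hb])] at h1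
  simp only [mem_singleton_iff, indicator_of_mem, Pi.one_apply, mul_one] at h1
  rw [← h1]
  simp only [walk_add]
  rw [lintegral_incLaw_split μ m
    (F := fun a s => Set.indicator {g * h} (1 : G → ℝ≥0∞) (a * walk s n))]
  · refine le_trans ?_ (ENNReal.le_tsum g)
    gcongr
    have h2 := lintegral_stepLaw μ n (fun b => Set.indicator {g * h} (1 : G → ℝ≥0∞) (g * b))
    rw [h2]
    refine le_trans ?_ (ENNReal.le_tsum h)
    simp
  · intro a
    exact (measurable_of_countable fun b => Set.indicator {g * h} (1 : G → ℝ≥0∞) (a * b)).comp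
      (measurable_walk_apply n)

/-- In this form, nondegeneracy makes the laws of the bundle from different starting points
equivalent. -/
theorem Nondegenerate.exists_stepLaw_ne_zero {μ : Measure G} [IsProbabilityMeasure μ]
    (hμ : Nondegenerate μ) (g : G) : ∃ n, stepLaw μ n {g} ≠ 0 := by
  have hg : g ∈ Subsemigroup.closure {g : G | μ {g} ≠ 0} := by rw [hμ]; trivial
  induction hg using Subsemigroup.closure_induction with
  | mem g hg => exact ⟨1, by rwa [stepLaw_one]⟩
  | mul g h _ _ hg hh =>
    obtain ⟨m, hm⟩ := hg
    obtain ⟨n, hn⟩ := hh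
    exact ⟨m + n, fun h0 => mul_ne_zero hm hn (le_zero_iff.1 (h0 ▸ stepLaw_mul_le μ m n g h))⟩

theorem Nondegenerate.inv {μ : Measure G} (hμ : Nondegenerate μ) : Nondegenerate μ.inv := by
  rw [Nondegenerate, eq_top_iff]
  intro g _
  have key : ∀ g ∈ Subsemigroup.closure {g : G | μ {g} ≠ 0},
      g⁻¹ ∈ Subsemigroup.closure {g : G | μ.inv {g} ≠ 0} := by
    intro g hg
    induction hg using Subsemigroup.closure_induction with
    | mem g hg => exact Subsemigroup.subset_closure (by simpa using hg)
    | mul g h _ _ hg hh => rw [mul_inv_rev]; exact mul_mem hh hg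
  have := key g⁻¹ (by rw [hμ]; trivial)
  rwa [inv_inv] at this

theorem FiniteEntropy.inv {μ : Measure G} (hμ : FiniteEntropy μ) : FiniteEntropy μ.inv := by
  have := (Equiv.inv G).summable_iff.2 hμ
  refine this.congr fun g => ?_
  simp [Measure.real]

theorem inv_inv_measure (μ : Measure G) : μ.inv.inv = μ := by
  refine Measure.ext_of_singleton fun g => ?_
  simp

end Increments

end PoissonBundle

/-! ### Lower bounds for Birkhoff sums by a maximal argument -/

namespace PoissonBundle

open scoped ENNReal

section Maximal

variable {Y : Type*}

/-- The maximum of the Birkhoff sums of `f` up to time `n`, the empty sum included. -/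
noncomputable def birkhoffMax (T : Y → Y) (f : Y → ℝ) : ℕ → Y → ℝ
  | 0, _ => 0
  | n + 1, y => max 0 (f y + birkhoffMax T f n (T y))

theorem birkhoffMax_nonneg (T : Y → Y) (f : Y → ℝ) (n : ℕ) (y : Y) : 0 ≤ birkhoffMax T f n y := by
  cases n with
  | zero => exact le_rfl
  | succ n => exact le_max_left _ _

theorem birkhoffMax_le_succ (T : Y → Y) (f : Y → ℝ) (n : ℕ) (y : Y) :
    birkhoffMax T f n y ≤ birkhoffMax T f (n + 1) y := by
  induction n generalizing y with
  | zero => exact birkhoffMax_nonneg T f 1 y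
  | succ n ih => exact max_le_max le_rfl (by gcongr; exact ih (T y))

theorem birkhoffSum_le_birkhoffMax (T : Y → Y) (f : Y → ℝ) (n : ℕ) (y : Y) :
    birkhoffSum T f n y ≤ birkhoffMax T f n y := by
  induction n generalizing y with
  | zero => simp [birkhoffMax]
  | succ n ih =>
    rw [birkhoffSum_succ']
    exact le_max_of_le_right (by gcongr; exact ih (T y))

/-- This invariance makes boundedness of the maxima an event that ergodicity decides. The recursion
bounds each of the two sequences by the other, up to the finite term `f y`. -/
theorem bddAbove_birkhoffMax_comp (T : Y → Y) (f : Y → ℝ) (y : Y) :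
    BddAbove (range fun n => birkhoffMax T f n (T y)) ↔
      BddAbove (range fun n => birkhoffMax T f n y) := by
  constructor
  · rintro ⟨C, hC⟩
    refine ⟨max 0 (f y + C), ?_⟩
    rintro _ ⟨n, rfl⟩
    refine (birkhoffMax_le_succ T f n y).trans (max_le_max le_rfl ?_)
    gcongr
    exact hC ⟨n, rfl⟩
  · rintro ⟨C, hC⟩
    refine ⟨C - f y, ?_⟩
    rintro _ ⟨n, rfl⟩
    have h1 : birkhoffMax T f (n + 1) y ≤ C := hC ⟨n + 1, rfl⟩
    have h2 : f y + birkhoffMax T f n (T y) ≤ birkhoffMax T f (n + 1) y := le_max_right _ _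
    simp only
    linarith

variable [MeasurableSpace Y] {ν : Measure Y}

theorem measurable_birkhoffMax {T : Y → Y} {f : Y → ℝ} (hT : Measurable T) (hf : Measurable f)
    (n : ℕ) : Measurable (birkhoffMax T f n) := by
  induction n with
  | zero => exact measurable_const
  | succ n ih => exact measurable_const.max (hf.add (ih.comp hT))

theorem integrable_birkhoffMax {T : Y → Y} {f : Y → ℝ} (hT : MeasurePreserving T ν ν)
    (hf : Integrable f ν) (n : ℕ) : Integrable (birkhoffMax T f n) ν := by
  induction n with
  | zero => exact integrable_zero _ _ _
  | succ n ih =>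
    exact (integrable_zero _ _ _).sup (hf.add (hT.integrable_comp_of_integrable ih))

/-- If the mean of `f` is negative, the Birkhoff sums of `f` over an ergodic transformation are
almost surely bounded above. -/
theorem bddAbove_birkhoffSum_of_integral_neg [IsProbabilityMeasure ν] {T : Y → Y} {f : Y → ℝ}
    (hT : Ergodic T ν) (hfm : Measurable f) (hf : Integrable f ν) (hneg : ∫ y, f y ∂ν < 0) :
    ∀ᵐ y ∂ν, BddAbove (range fun n => birkhoffSum T f n y) := by
  have hTp := hT.toMeasurePreserving
  have hmeas : MeasurableSet {y | BddAbove (range fun n => birkhoffMax T f n y)} :=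
    measurableSet_bddAbove_range fun n => measurable_birkhoffMax hTp.measurable hfm n
  rcases hT.toPreErgodic.ae_mem_or_ae_notMem hmeas
    (by ext y; exact bddAbove_birkhoffMax_comp T f y) with h | h
  · filter_upwards [h] with y hy
    obtain ⟨C, hC⟩ := hy
    refine ⟨C, ?_⟩
    rintro _ ⟨n, rfl⟩
    exact (birkhoffSum_le_birkhoffMax T f n y).trans (hC ⟨n, rfl⟩)
  -- If the maxima are unbounded, the truncations of f from below by `-birkhoffMax T f n (T y)`
  -- converge to f, dominated by |f|. Their integrals turn out to be nonnegative, against the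
  -- negative mean of f.
  · exfalso
    have hmono : ∀ y, Monotone fun n => birkhoffMax T f n y :=
      fun y => monotone_nat_of_le_succ fun n => birkhoffMax_le_succ T f n y
    have htend : Tendsto (fun n => ∫ y, max (f y) (-birkhoffMax T f n (T y)) ∂ν) atTop
        (nhds (∫ y, f y ∂ν)) := by
      refine tendsto_integral_of_dominated_convergence (fun y => |f y|)
        (fun n => (hfm.max ((measurable_birkhoffMax hTp.measurable hfm n).comp
          hTp.measurable).neg).aestronglyMeasurable) hf.abs ?_ ?_
      · intro n
        refine Eventually.of_forall fun y => ?_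
        have := birkhoffMax_nonneg T f n (T y)
        rw [Real.norm_eq_abs, abs_le]
        constructor
        · exact (neg_abs_le _).trans (le_max_left _ _)
        · exact max_le (le_abs_self _) (by have := abs_nonneg (f y); linarith)
      · filter_upwards [h] with y hy
        replace hy : ¬BddAbove (range fun n => birkhoffMax T f n y) := hy
        rw [← bddAbove_birkhoffMax_comp] at hy
        have h1 : Tendsto (fun n => birkhoffMax T f n (T y)) atTop atTop :=
          tendsto_atTop_atTop_of_monotone (hmono (T y)) fun C => by
            by_contra hC
            push Not at hC
            exact hy ⟨C, by rintro _ ⟨n, rfl⟩; exact (hC n).le⟩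
        refine tendsto_const_nhds.congr' ?_
        filter_upwards [h1.eventually_ge_atTop (-f y)] with n hn
        rw [max_eq_left]; linarith
    have hnn : ∀ n, 0 ≤ ∫ y, max (f y) (-birkhoffMax T f n (T y)) ∂ν := by
      intro n
      -- By the recursion and the invariance of ν, the integral of the truncation is that of the
      -- increment of the maxima from n to n + 1, and the maxima are monotone.
      have h1 : ∀ y, max (f y) (-birkhoffMax T f n (T y)) =
          birkhoffMax T f (n + 1) y - birkhoffMax T f n (T y) := by
        intro y
        simp only [birkhoffMax]
        rcases le_total (f y) (-birkhoffMax T f n (T y)) with h | h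
        · rw [max_eq_right h, max_eq_left (by linarith)]; ring
        · rw [max_eq_left h, max_eq_right (by linarith)]; ring
      have h2 := integrable_birkhoffMax hTp hf n
      have h3 : ∫ y, birkhoffMax T f n (T y) ∂ν = ∫ y, birkhoffMax T f n y ∂ν := by
        conv_rhs => rw [← hTp.map_eq]
        rw [integral_map hTp.measurable.aemeasurable
          (measurable_birkhoffMax hTp.measurable hfm n).aestronglyMeasurable]
      simp_rw [h1]
      rw [integral_sub (integrable_birkhoffMax hTp hf (n + 1))
        (show Integrable (fun y => birkhoffMax T f n (T y)) ν from
          hTp.integrable_comp_of_integrable h2), h3, sub_nonneg]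
      exact integral_mono h2 (integrable_birkhoffMax hTp hf (n + 1))
        fun y => birkhoffMax_le_succ T f n y
    exact absurd (ge_of_tendsto' htend hnn) (not_le.2 hneg)

/-- If the mean of `f` exceeds `c`, then almost surely the Birkhoff sums of `f` over an ergodic
transformation eventually exceed `n c`. -/
theorem eventually_lt_birkhoffSum [IsProbabilityMeasure ν] {T : Y → Y} {f : Y → ℝ}
    (hT : Ergodic T ν) (hfm : Measurable f) (hf : Integrable f ν) {c : ℝ}
    (hc : c < ∫ y, f y ∂ν) : ∀ᵐ y ∂ν, ∀ᶠ n : ℕ in atTop, n * c < birkhoffSum T f n y := by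
  obtain ⟨d, hcd, hd⟩ := exists_between hc
  -- With d strictly between c and the mean, the sums of d - f are bounded above, and the gap n (d -
  -- c) outgrows the bound.
  have h := bddAbove_birkhoffSum_of_integral_neg (f := fun y => d - f y) hT
    (measurable_const.sub hfm) ((integrable_const d).sub hf) (by
      rw [integral_sub (integrable_const d) hf]; simpa using hd)
  filter_upwards [h] with y hy
  obtain ⟨C, hC⟩ := hy
  have h1 : Tendsto (fun n : ℕ => (n : ℝ) * (d - c)) atTop atTop :=
    tendsto_natCast_atTop_atTop.atTop_mul_const (sub_pos.2 hcd)
  filter_upwards [h1.eventually_gt_atTop C] with n hn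
  have h2 : birkhoffSum T (fun y => d - f y) n y ≤ C := hC ⟨n, rfl⟩
  have h3 : birkhoffSum T (fun y => d - f y) n y = n * d - birkhoffSum T f n y := by
    simp [birkhoffSum]
  nlinarith

end Maximal

end PoissonBundle

/-! ### Ergodicity of the skew shift -/

namespace PoissonBundle

open scoped ENNReal

section Skew

variable {G : Type*} [Group G] [MeasurableSpace G] [Countable G] [DiscreteMeasurableSpace G]
  {X : Type*} [MeasurableSpace X] {μ : Measure G} [IsProbabilityMeasure μ] {η : Measure X}
  [IsProbabilityMeasure η]

theorem measurePreserving_cons (μ : Measure G) [IsProbabilityMeasure μ] (η : Measure X)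
    [IsProbabilityMeasure η] :
    MeasurePreserving (fun p : G × X × (ℕ → G) => (p.2.1, consSeq p.1 p.2.2))
      (μ.prod (η.prod (incLaw μ))) (η.prod (incLaw μ)) := by
  have h1 : MeasurePreserving (fun p : G × (ℕ → G) => consSeq p.1 p.2) (μ.prod (incLaw μ))
      (incLaw μ) := ⟨measurable_consSeq, map_consSeq μ⟩
  have h2 := (MeasurePreserving.id η).prod h1
  have h3 := measurePreserving_prodAssoc η μ (incLaw μ)
  have h4 := (Measure.measurePreserving_swap (μ := μ) (ν := η)).prod
    (MeasurePreserving.id (incLaw μ))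
  have h5 := (measurePreserving_prodAssoc μ η (incLaw μ)).symm
  exact h2.comp (h3.comp (h4.comp h5))

/-- The cylinder `{(x, s) | x ∈ A, s i ∈ t i for i < n}`. -/
def incCylinder (A : Set X) (t : ℕ → Set G) (n : ℕ) : Set (X × (ℕ → G)) :=
  {y | y.1 ∈ A ∧ ∀ i < n, y.2 i ∈ t i}

theorem measurableSet_incCylinder {A : Set X} (hA : MeasurableSet A) (t : ℕ → Set G) (n : ℕ) :
    MeasurableSet (incCylinder A t n) := by
  refine (measurable_fst hA).inter ?_
  have : {y : X × (ℕ → G) | ∀ i < n, y.2 i ∈ t i} =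
      ⋂ i, ⋂ _ : i < n, (fun y : X × (ℕ → G) => y.2 i) ⁻¹' t i := by
    ext y; simp
  change MeasurableSet {y : X × (ℕ → G) | ∀ i < n, y.2 i ∈ t i}
  rw [this]
  exact MeasurableSet.iInter fun i => MeasurableSet.iInter fun _ =>
    ((measurable_pi_apply i).comp measurable_snd) (MeasurableSet.of_discrete (s := t i))

theorem isPiSystem_incCylinder :
    IsPiSystem {C : Set (X × (ℕ → G)) | ∃ A t n, MeasurableSet A ∧ C = incCylinder A t n} := by
  rintro _ ⟨A, t, n, hA, rfl⟩ _ ⟨B, u, m, hB, rfl⟩ _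
  refine ⟨A ∩ B, fun i => {g | (i < n → g ∈ t i) ∧ (i < m → g ∈ u i)}, max n m, hA.inter hB, ?_⟩
  ext y
  simp only [incCylinder, mem_inter_iff, mem_ofPred_eq, lt_max_iff]
  constructor
  · rintro ⟨⟨h1, h2⟩, h3, h4⟩
    exact ⟨⟨h1, h3⟩, fun i _ => ⟨h2 i, h4 i⟩⟩
  · rintro ⟨⟨h1, h3⟩, h⟩
    exact ⟨⟨h1, fun i hi => (h i (Or.inl hi)).1 hi⟩, h3, fun i hi => (h i (Or.inr hi)).2 hi⟩

theorem generateFrom_incCylinder :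
    (inferInstance : MeasurableSpace (X × (ℕ → G))) = MeasurableSpace.generateFrom
      {C : Set (X × (ℕ → G)) | ∃ A t n, MeasurableSet A ∧ C = incCylinder A t n} := by
  classical
  refine le_antisymm ?_ (MeasurableSpace.generateFrom_le ?_)
  · refine sup_le ?_ ?_
    · rintro _ ⟨A, hA, rfl⟩
      exact MeasurableSpace.measurableSet_generateFrom
        ⟨A, fun _ => univ, 0, hA, by ext y; simp [incCylinder]⟩
    · simp only [MeasurableSpace.pi, MeasurableSpace.comap_iSup, MeasurableSpace.comap_comp]
      refine iSup_le fun i => ?_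
      rintro _ ⟨B, -, rfl⟩
      refine MeasurableSpace.measurableSet_generateFrom
        ⟨univ, fun j => if j = i then B else univ, i + 1, MeasurableSet.univ, ?_⟩
      ext y
      simp only [incCylinder, mem_preimage, Function.comp, mem_univ, true_and, mem_ofPred_eq]
      constructor
      · intro h j _
        split_ifs with hj
        · exact hj ▸ h
        · trivial
      · intro h
        simpa using h i (Nat.lt_succ_self i)
  · rintro _ ⟨A, t, n, hA, rfl⟩
    exact measurableSet_incCylinder hA t n

/-- A consistent family of functions of the trajectory, indexed by the starting point, vanishes as
soon as its integrals over all the subsets of the base vanish. -/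
theorem ae_eq_zero_of_forall_base_integral_eq_zero {f : G → X × (ℕ → G) → ℝ}
    (hf : ∀ g, Integrable (f g) (η.prod (incLaw μ)))
    (hstep : ∀ g x h s, f g (x, consSeq h s) = f (g * h) (x, s))
    (hbase : ∀ g A, MeasurableSet A → ∫ y in Prod.fst ⁻¹' A, f g y ∂(η.prod (incLaw μ)) = 0)
    (g : G) : f g =ᵐ[η.prod (incLaw μ)] 0 := by
  have hcyl : ∀ n A t g, MeasurableSet A →
      ∫ y in incCylinder A t n, f g y ∂(η.prod (incLaw μ)) = 0 := by
    intro n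
    induction n with
    | zero =>
      intro A t g hA
      have : incCylinder A t 0 = Prod.fst ⁻¹' A := by ext y; simp [incCylinder]
      rw [this, hbase g A hA]
    | succ n ih =>
      intro A t g hA
      have hm := measurableSet_incCylinder hA t (n + 1)
      have hi := (hf g).indicator hm
      have hmp := measurePreserving_cons μ η
      rw [← integral_indicator hm]
      conv_lhs => rw [← hmp.map_eq]
      rw [integral_map hmp.measurable.aemeasurable (by rw [hmp.map_eq]; exact hi.1)]
      have hi' : Integrable (fun p : G × X × (ℕ → G) =>
          (incCylinder A t (n + 1)).indicator (f g) (p.2.1, consSeq p.1 p.2.2))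
          (μ.prod (η.prod (incLaw μ))) := hmp.integrable_comp_of_integrable hi
      rw [integral_prod _ hi']
      refine integral_eq_zero_of_ae (Eventually.of_forall fun h => ?_)
      simp only [Pi.zero_apply]
      -- Fixing the first increment h turns a cylinder of length n + 1 into one of length n seen
      -- from the starting point g * h, where the induction hypothesis applies.
      have key : ∀ y : X × (ℕ → G),
          (incCylinder A t (n + 1)).indicator (f g) (y.1, consSeq h y.2) =
          (t 0).indicator 1 h *
            (incCylinder A (fun i => t (i + 1)) n).indicator (f (g * h)) y := by
        intro y
        have hiff : (y.1, consSeq h y.2) ∈ incCylinder A t (n + 1) ↔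
            h ∈ t 0 ∧ y ∈ incCylinder A (fun i => t (i + 1)) n := by
          simp only [incCylinder, mem_ofPred_eq]
          constructor
          · rintro ⟨h1, h2⟩
            exact ⟨h2 0 (Nat.succ_pos n), h1, fun i hi => h2 (i + 1) (by omega)⟩
          · rintro ⟨h0, h1, h2⟩
            refine ⟨h1, fun i hi => ?_⟩
            cases i with
            | zero => exact h0
            | succ i => exact h2 i (by omega)
        by_cases h0 : h ∈ t 0 <;>
          by_cases h1 : y ∈ incCylinder A (fun i => t (i + 1)) n <;>
          simp [indicator, hiff, h0, h1, hstep]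
      simp_rw [key]
      rw [integral_const_mul, integral_indicator (measurableSet_incCylinder hA _ n),
        ih A _ (g * h) hA, mul_zero]
  have htot : ∫ y, f g y ∂(η.prod (incLaw μ)) = 0 := by
    have := hbase g univ MeasurableSet.univ
    rwa [preimage_univ, setIntegral_univ] at this
  refine (hf g).ae_eq_zero_of_forall_setIntegral_eq_zero fun E hE _ => ?_
  refine MeasurableSpace.induction_on_inter
    (C := fun E _ => ∫ y in E, f g y ∂(η.prod (incLaw μ)) = 0) generateFrom_incCylinder
    isPiSystem_incCylinder (by simp) ?_ ?_ ?_ E hE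
  · rintro _ ⟨A, t, n, hA, rfl⟩
    exact hcyl n A t g hA
  · intro E hE ih
    have := integral_add_compl hE (hf g)
    rwa [ih, htot, zero_add] at this
  · intro E hd hE ih
    rw [integral_iUnion hE hd (hf g).integrableOn]
    simp [ih]

variable [MulAction G X]

/-- The transformation `(x, s) ↦ (s_0⁻¹ • x, (s_{n+1})_n)`. -/
def incShift (y : X × (ℕ → G)) : X × (ℕ → G) := ((y.2 0)⁻¹ • y.1, tailSeq y.2)

variable [MeasurableConstSMul G X]

theorem measurable_inv_smul_fst {B : Type*} [MeasurableSpace B] :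
    Measurable fun p : G × X × B => (p.1⁻¹ • p.2.1, p.2.2) :=
  measurable_from_prod_countable_right fun g =>
    ((measurable_const_smul g⁻¹).comp measurable_fst).prodMk measurable_snd

theorem measurePreserving_inv_smul_fst [SMulInvariantMeasure G X η] {B : Type*}
    [MeasurableSpace B] (β : Measure B) [IsProbabilityMeasure β] :
    MeasurePreserving (fun p : G × X × B => (p.1⁻¹ • p.2.1, p.2.2)) (μ.prod (η.prod β))
      (η.prod β) := by
  refine ⟨measurable_inv_smul_fst, Measure.ext fun E hE => ?_⟩
  rw [Measure.map_apply measurable_inv_smul_fst hE,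
    Measure.prod_apply (measurable_inv_smul_fst hE)]
  have : ∀ g : G, (η.prod β) (Prod.mk g ⁻¹' ((fun p : G × X × B => (p.1⁻¹ • p.2.1, p.2.2)) ⁻¹' E))
      = (η.prod β) E := fun g =>
    ((measurePreserving_smul g⁻¹ η).prod (MeasurePreserving.id β)).measure_preimage
      hE.nullMeasurableSet
  simp [this]

theorem measurable_incShift : Measurable (incShift : X × (ℕ → G) → X × (ℕ → G)) :=
  (measurable_inv_smul_fst (G := G)).comp
    (((measurable_pi_apply 0).comp measurable_snd).prodMk
      (measurable_fst.prodMk (measurable_tailSeq.comp measurable_snd)))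

/-- After a fresh first increment g is put in front, the transformation becomes (g, x, s) ↦ (g⁻¹ •
x, s), and each g preserves η. -/
theorem measurePreserving_incShift [SMulInvariantMeasure G X η] :
    MeasurePreserving incShift (η.prod (incLaw μ)) (η.prod (incLaw μ)) := by
  refine ⟨measurable_incShift, ?_⟩
  conv_lhs => rw [← (measurePreserving_cons μ η).map_eq]
  rw [Measure.map_map measurable_incShift (measurePreserving_cons μ η).measurable]
  exact (measurePreserving_inv_smul_fst (μ := μ) (η := η) (incLaw μ)).map_eq

/-- By invariance of η, the squared L² distance between φ and its translate by g is 2(‖φ‖² - ⟨φ, φ ∘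
g⁻¹⟩). Harmonicity makes the μ-average of this nonnegative quantity zero, so it vanishes at every
atom of μ. -/
theorem ae_eq_of_harmonic [SMulInvariantMeasure G X η] {φ : X → ℝ} (hφ : Measurable φ)
    (h0 : ∀ x, 0 ≤ φ x) (h1 : ∀ x, φ x ≤ 1) (hharm : ∀ x, φ x = ∫ g : G, φ (g⁻¹ • x) ∂μ)
    {g : G} (hg : μ {g} ≠ 0) : ∀ᵐ x ∂η, φ (g⁻¹ • x) = φ x := by
  have hb : ∀ x, ‖φ x‖ ≤ 1 := fun x => by rw [Real.norm_eq_abs, abs_of_nonneg (h0 x)]; exact h1 x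
  have hmg : ∀ g : G, Measurable fun x => φ (g⁻¹ • x) :=
    fun g => hφ.comp (measurable_const_smul g⁻¹)
  have hmul : ∀ a b : X → ℝ, Measurable a → Measurable b → (∀ x, ‖a x‖ ≤ 1) →
      (∀ x, ‖b x‖ ≤ 1) → Integrable (fun x => a x * b x) η := fun a b ha hb' h h' =>
    Integrable.of_bound (ha.mul hb').aestronglyMeasurable 1 (Eventually.of_forall fun x => by
      rw [norm_mul]; exact mul_le_one₀ (h x) (norm_nonneg _) (h' x))
  set c := ∫ x, φ x * φ x ∂η with hc
  have hI : ∀ g : G, ∫ x, (φ (g⁻¹ • x) - φ x) ^ 2 ∂η = 2 * (c - ∫ x, φ x * φ (g⁻¹ • x) ∂η) := by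
    intro g
    have e1 : ∫ x, φ (g⁻¹ • x) * φ (g⁻¹ • x) ∂η = c := by
      have := (measurePreserving_smul g⁻¹ η).integral_comp' (f := MeasurableEquiv.smul g⁻¹)
        (fun x => φ x * φ x)
      exact this
    have e2 : ∀ x, (φ (g⁻¹ • x) - φ x) ^ 2 =
        (φ (g⁻¹ • x) * φ (g⁻¹ • x) + φ x * φ x) - 2 * (φ x * φ (g⁻¹ • x)) := fun x => by ring
    have i1 := hmul _ _ (hmg g) (hmg g) (fun _ => hb _) (fun _ => hb _)
    have i2 := hmul _ _ hφ hφ hb hb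
    have i3 := hmul _ _ hφ (hmg g) hb (fun _ => hb _)
    simp_rw [e2]
    have i12 : Integrable (fun x => φ (g⁻¹ • x) * φ (g⁻¹ • x) + φ x * φ x) η := i1.add i2
    rw [integral_sub i12 (i3.const_mul 2), integral_add i1 i2, integral_const_mul, e1]
    ring
  have hjm : Measurable fun p : G × X => φ p.2 * φ (p.1⁻¹ • p.2) :=
    measurable_from_prod_countable_right fun g => hφ.mul (hmg g)
  have hji : Integrable (fun p : G × X => φ p.2 * φ (p.1⁻¹ • p.2)) (μ.prod η) :=
    Integrable.of_bound hjm.aestronglyMeasurable 1 (Eventually.of_forall fun p => by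
      rw [norm_mul]; exact mul_le_one₀ (hb _) (norm_nonneg _) (hb _))
  have hz : ∫ g : G, (c - ∫ x, φ x * φ (g⁻¹ • x) ∂η) ∂μ = 0 := by
    rw [integral_sub (integrable_const c) hji.integral_prod_left, integral_integral_swap
      (f := fun (g : G) x => φ x * φ (g⁻¹ • x)) hji]
    simp_rw [integral_const_mul, ← hharm]
    simp [hc]
  have hnn : ∀ g : G, 0 ≤ c - ∫ x, φ x * φ (g⁻¹ • x) ∂η := fun g => by
    have h2 : 0 ≤ ∫ x, (φ (g⁻¹ • x) - φ x) ^ 2 ∂η := integral_nonneg fun x => sq_nonneg _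
    rw [hI g] at h2
    linarith
  have hzero := (integral_eq_zero_iff_of_nonneg hnn
    ((integrable_const c).sub hji.integral_prod_left)).1 hz
  have hgz : c - ∫ x, φ x * φ (g⁻¹ • x) ∂η = 0 := by
    by_contra hne
    refine hg (measure_mono_null ?_ hzero)
    rintro _ rfl
    exact hne
  have h3 := hI g
  rw [hgz, mul_zero] at h3
  have h4 := (integral_eq_zero_iff_of_nonneg (fun x => sq_nonneg _)
    (Integrable.of_bound (((hmg g).sub hφ).pow_const 2).aestronglyMeasurable 1
      (Eventually.of_forall fun x => by
        rw [norm_pow, Real.norm_eq_abs]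
        have a1 := h0 x; have a2 := h1 x; have a3 := h0 (g⁻¹ • x); have a4 := h1 (g⁻¹ • x)
        simp only [Pi.sub_apply]
        exact pow_le_one₀ (abs_nonneg _) (abs_le.2 ⟨by linarith, by linarith⟩)))).1 h3
  filter_upwards [h4] with x hx
  exact sub_eq_zero.1 (pow_eq_zero_iff (two_ne_zero) |>.1 hx)

theorem ae_const_of_harmonic [ErgodicSMul G X η] (hμ : Nondegenerate μ) {φ : X → ℝ}
    (hφ : Measurable φ) (h0 : ∀ x, 0 ≤ φ x) (h1 : ∀ x, φ x ≤ 1)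
    (hharm : ∀ x, φ x = ∫ g : G, φ (g⁻¹ • x) ∂μ) : ∃ c, φ =ᵐ[η] fun _ => c := by
  have hall : ∀ g : G, ∀ᵐ x ∂η, φ (g⁻¹ • x) = φ x := by
    intro g
    have hg : g ∈ Subsemigroup.closure {g : G | μ {g} ≠ 0} := by rw [hμ]; trivial
    induction hg using Subsemigroup.closure_induction with
    | mem g hg => exact ae_eq_of_harmonic hφ h0 h1 hharm hg
    | mul g h _ _ hg hh =>
      filter_upwards [hg, (measurePreserving_smul g⁻¹ η).quasiMeasurePreserving.ae hh] with x h2 h3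
      rw [mul_inv_rev, mul_smul, h3, h2]
  refine exists_eventuallyEq_const_of_forall_separating MeasurableSet fun U hU => ?_
  refine eventuallyConst_set.1 (aeconst_of_forall_preimage_smul_ae_eq G
    (hφ hU).nullMeasurableSet fun g => ?_)
  refine ((hall g⁻¹).mono fun x hx => ?_).set_eq
  rw [inv_inv] at hx
  change φ (g • x) ∈ U ↔ φ x ∈ U
  rw [hx]

/-- The probability that an invariant set E contains the trajectory from x is a bounded harmonic
function of x, hence a constant c. The indicators of the translates of E, minus c, form a consistent
family with vanishing integrals over the base, so the indicator of E is c almost everywhere. -/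
theorem ergodic_incShift [ErgodicSMul G X η] (hμ : Nondegenerate μ) :
    Ergodic incShift (η.prod (incLaw μ)) := by
  refine ⟨measurePreserving_incShift, ⟨fun {E} hE hinv => ?_⟩⟩
  have hEiff : ∀ x g s, (x, consSeq g s) ∈ E ↔ (g⁻¹ • x, s) ∈ E := fun x g s => by
    conv_lhs => rw [← hinv]
    rfl
  have hsec : Measurable fun x => incLaw μ (Prod.mk x ⁻¹' E) := measurable_measure_prodMk_left hE
  set φ : X → ℝ := fun x => (incLaw μ (Prod.mk x ⁻¹' E)).toReal with hφdef
  have hφ : Measurable φ := hsec.ennreal_toReal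
  have hharm : ∀ x, φ x = ∫ g : G, φ (g⁻¹ • x) ∂μ := by
    intro x
    have hEx : MeasurableSet (Prod.mk x ⁻¹' E) := measurable_prodMk_left hE
    rw [integral_toReal (measurable_of_countable _).aemeasurable
      (Eventually.of_forall fun g => measure_lt_top _ _)]
    simp only [hφdef]
    conv_lhs => rw [← map_consSeq μ]
    rw [Measure.map_apply measurable_consSeq hEx, Measure.prod_apply (measurable_consSeq hEx)]
    congr 1
    refine lintegral_congr fun g => ?_
    congr 1
    ext s
    exact hEiff x g s
  obtain ⟨c, hc⟩ := ae_const_of_harmonic (μ := μ) (η := η) hμ hφ (fun _ => ENNReal.toReal_nonneg)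
    (fun x => ENNReal.toReal_le_of_le_ofReal zero_le_one (by simpa using prob_le_one)) hharm
  have hEg : ∀ g : G, MeasurableSet {y : X × (ℕ → G) | (g⁻¹ • y.1, y.2) ∈ E} := fun g =>
    (((measurable_const_smul g⁻¹).comp measurable_fst).prodMk measurable_snd) hE
  have hint : ∀ g : G, Integrable (fun y : X × (ℕ → G) =>
      {y : X × (ℕ → G) | (g⁻¹ • y.1, y.2) ∈ E}.indicator (1 : X × (ℕ → G) → ℝ) y - c)
      (η.prod (incLaw μ)) := fun g =>
    ((integrable_const (1 : ℝ)).indicator (hEg g)).sub (integrable_const c)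
  have hzero := ae_eq_zero_of_forall_base_integral_eq_zero (μ := μ) (η := η)
    (f := fun g y => {y : X × (ℕ → G) | (g⁻¹ • y.1, y.2) ∈ E}.indicator 1 y - c) hint
    (by
      intro g x h s
      have : (x, consSeq h s) ∈ {y : X × (ℕ → G) | (g⁻¹ • y.1, y.2) ∈ E} ↔
          (x, s) ∈ {y : X × (ℕ → G) | ((g * h)⁻¹ • y.1, y.2) ∈ E} := by
        simp only [mem_ofPred_eq]
        rw [hEiff, mul_inv_rev, mul_smul]
      by_cases hs : (x, s) ∈ {y : X × (ℕ → G) | ((g * h)⁻¹ • y.1, y.2) ∈ E}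
      · rw [indicator_of_mem hs, indicator_of_mem (this.2 hs)]; rfl
      · rw [indicator_of_notMem hs, indicator_of_notMem (fun h' => hs (this.1 h'))])
    (by
      intro g A hA
      have : (Prod.fst ⁻¹' A : Set (X × (ℕ → G))) = A ×ˢ univ := by ext y; simp
      rw [this, setIntegral_prod _ (hint g).integrableOn]
      refine integral_eq_zero_of_ae (ae_restrict_of_ae ?_)
      filter_upwards [(measurePreserving_smul g⁻¹ η).quasiMeasurePreserving.ae hc] with x hx
      simp only [setIntegral_univ, Pi.zero_apply]
      have hm : MeasurableSet {s : ℕ → G | (g⁻¹ • x, s) ∈ E} := measurable_prodMk_left hE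
      have e : ∀ s : ℕ → G,
          {y : X × (ℕ → G) | (g⁻¹ • y.1, y.2) ∈ E}.indicator (1 : X × (ℕ → G) → ℝ) (x, s)
          = {s : ℕ → G | (g⁻¹ • x, s) ∈ E}.indicator 1 s := fun s => rfl
      simp_rw [e]
      have hi1 : Integrable ({s : ℕ → G | (g⁻¹ • x, s) ∈ E}.indicator (1 : (ℕ → G) → ℝ))
          (incLaw μ) := (integrable_const (1 : ℝ)).indicator hm
      rw [integral_sub hi1 (integrable_const c),
        integral_indicator_one hm]
      simp only [integral_const, probReal_univ, one_smul]
      rw [sub_eq_zero, ← hx]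
      rfl) 1
  rw [eventuallyConst_set]
  by_cases hc1 : c = 1
  · left
    filter_upwards [hzero] with y hy
    by_contra hyE
    simp [indicator, hyE, hc1] at hy
  · right
    filter_upwards [hzero] with y hy hyE
    simp [indicator, hyE] at hy
    exact hc1 (by linarith)

end Skew

end PoissonBundle

/-! ### Images of coset trajectories and their densities -/

namespace PoissonBundle

open scoped ENNReal

section Trajectories

variable {G : Type*} [Group G] [MeasurableSpace G]
  {X : Type*} [MeasurableSpace X] [MulAction G X] {Z : Type*} [MeasurableSpace Z] [MulAction G Z]

/-- A family of functions `z g` of the trajectory `(L_x g ω_n)_n` of cosets (given by the point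
`x` and the increments), which is invariant under the time shift and equivariant. -/
structure IsTrajMap (μ : Measure G) (η : Measure X) (L : X → Subgroup G)
    (z : G → X × (ℕ → G) → Z) : Prop where
  measurable : ∀ g, Measurable (z g)
  step : ∀ g x h s, z g (x, consSeq h s) = z (g * h) (x, s)
  equivariant : ∀ g, ∀ᵐ y ∂(η.prod (incLaw μ)), z g (g • y.1, y.2) = g • z 1 y
  coset : ∀ g l x s, l ∈ L x → z (l * g) (x, s) = z g (x, s)

/-- The law of `(x, z g (x, s))`. -/
noncomputable def bundleLaw (μ : Measure G) (η : Measure X) (z : G → X × (ℕ → G) → Z) (g : G) :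
    Measure (X × Z) :=
  (η.prod (incLaw μ)).map fun y => (y.1, z g y)

/-- The density of the law of the bundle started at `g` with respect to the law of the bundle
started at the identity. -/
noncomputable def bundleDensity (μ : Measure G) (η : Measure X) (z : G → X × (ℕ → G) → Z) (g : G) :
    X × Z → ℝ≥0∞ :=
  (bundleLaw μ η z g).rnDeriv (bundleLaw μ η z 1)

theorem measurable_bundleDensity (μ : Measure G) (η : Measure X) (z : G → X × (ℕ → G) → Z) (g : G) :
    Measurable (bundleDensity μ η z g) :=
  Measure.measurable_rnDeriv _ _

instance measurableConstSMul_prod [MeasurableConstSMul G X] [MeasurableConstSMul G Z] :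
    MeasurableConstSMul G (X × Z) :=
  ⟨fun g => ((measurable_const_smul g).comp measurable_fst).prodMk
    ((measurable_const_smul g).comp measurable_snd)⟩

variable {μ : Measure G} [IsProbabilityMeasure μ] {η : Measure X} [IsProbabilityMeasure η]
  {L : X → Subgroup G} {z : G → X × (ℕ → G) → Z}

instance (g : G) : IsFiniteMeasure (bundleLaw μ η z g) := by
  unfold bundleLaw; infer_instance

namespace IsTrajMap

variable [Countable G] [DiscreteMeasurableSpace G]

theorem measurable_mk (hz : IsTrajMap μ η L z) (g : G) : Measurable fun y => (y.1, z g y) :=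
  measurable_fst.prodMk (hz.measurable g)

theorem isProbabilityMeasure (hz : IsTrajMap μ η L z) (g : G) :
    IsProbabilityMeasure (bundleLaw μ η z g) :=
  Measure.isProbabilityMeasure_map (hz.measurable_mk g).aemeasurable

theorem walk_tail (hz : IsTrajMap μ η L z) (n : ℕ) (g : G) (x : X) (s : ℕ → G) :
    z g (x, s) = z (g * walk s n) (x, tailSeq^[n] s) := by
  induction n generalizing g s with
  | zero => simp [walk]
  | succ n ih =>
    conv_lhs => rw [← consSeq_head_tail s]
    rw [hz.step, ih, walk_succ', mul_assoc]
    rfl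

theorem lintegral_bundleLaw (hz : IsTrajMap μ η L z) (g : G) {F : X × Z → ℝ≥0∞}
    (hF : Measurable F) :
    ∫⁻ w, F w ∂(bundleLaw μ η z g) = ∫⁻ y, F (y.1, z g y) ∂(η.prod (incLaw μ)) :=
  lintegral_map hF (hz.measurable_mk g)

/-- Shift invariance lets the point of the bundle be read off the trajectory after time n. Given
that the walk is at g at time n, the pair (x, point) therefore has law `bundleLaw μ η z g`. -/
theorem lintegral_walk (hz : IsTrajMap μ η L z) (n : ℕ) {F : G → X × Z → ℝ≥0∞}
    (hF : ∀ g, Measurable (F g)) :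
    ∫⁻ y, F (walk y.2 n) (y.1, z 1 y) ∂(η.prod (incLaw μ)) =
      ∑' g, stepLaw μ n {g} * ∫⁻ w, F g w ∂(bundleLaw μ η z g) := by
  have hF' : Measurable fun p : G × X × Z => F p.1 p.2 := measurable_from_prod_countable_right hF
  have hm : ∀ g, Measurable fun y : X × (ℕ → G) => F g (y.1, z g y) := fun g =>
    (hF g).comp (hz.measurable_mk g)
  have hm' : Measurable fun y : X × (ℕ → G) => F (walk y.2 n) (y.1, z 1 y) :=
    hF'.comp (((measurable_walk_apply n).comp measurable_snd).prodMk (hz.measurable_mk 1))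
  rw [lintegral_prod _ hm'.aemeasurable]
  have h1 : ∀ x, ∫⁻ s, F (walk s n) (x, z 1 (x, s)) ∂(incLaw μ) =
      ∑' g, stepLaw μ n {g} * ∫⁻ s, F g (x, z g (x, s)) ∂(incLaw μ) := by
    intro x
    rw [← lintegral_incLaw_split μ n (F := fun g s => F g (x, z g (x, s)))
      fun g => (hm g).comp measurable_prodMk_left]
    refine lintegral_congr fun s => ?_
    rw [hz.walk_tail n 1 x s, one_mul]
  simp_rw [h1]
  rw [lintegral_tsum fun g => ((hm g).lintegral_prod_right'.const_mul _).aemeasurable]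
  refine tsum_congr fun g => ?_
  rw [lintegral_const_mul _ (hm g).lintegral_prod_right', hz.lintegral_bundleLaw g (hF g),
    lintegral_prod _ (hm g).aemeasurable]

theorem lintegral_head (hz : IsTrajMap μ η L z) {F : G → X × Z → ℝ≥0∞}
    (hF : ∀ g, Measurable (F g)) :
    ∫⁻ y, F (y.2 0) (y.1, z 1 y) ∂(η.prod (incLaw μ)) =
      ∑' g, μ {g} * ∫⁻ w, F g w ∂(bundleLaw μ η z g) := by
  have := hz.lintegral_walk 1 hF
  rw [stepLaw_one] at this
  rw [← this]
  simp [walk]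

theorem bundleLaw_one_apply (hz : IsTrajMap μ η L z) (n : ℕ) {E : Set (X × Z)}
    (hE : MeasurableSet E) :
    bundleLaw μ η z 1 E = ∑' g, stepLaw μ n {g} * bundleLaw μ η z g E := by
  have := hz.lintegral_walk n (F := fun _ => E.indicator 1) fun _ => measurable_one.indicator hE
  simp_rw [lintegral_indicator_one hE] at this
  rw [← this, ← hz.lintegral_bundleLaw 1 (measurable_one.indicator hE), lintegral_indicator_one hE]

variable [MeasurableConstSMul G X] [MeasurableConstSMul G Z] [SMulInvariantMeasure G X η]

theorem map_smul_bundleLaw_one (hz : IsTrajMap μ η L z) (g : G) :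
    (bundleLaw μ η z 1).map (g • ·) = bundleLaw μ η z g := by
  have hmp : MeasurePreserving (fun y : X × (ℕ → G) => (g • y.1, y.2)) (η.prod (incLaw μ))
      (η.prod (incLaw μ)) :=
    (measurePreserving_smul g η).prod (MeasurePreserving.id (incLaw μ))
  rw [bundleLaw, Measure.map_map (measurable_const_smul g) (hz.measurable_mk 1), bundleLaw]
  conv_rhs => rw [← hmp.map_eq]
  rw [Measure.map_map (hz.measurable_mk g) hmp.measurable]
  refine Measure.map_congr ?_
  filter_upwards [hz.equivariant g] with y hy
  exact Prod.ext rfl hy.symm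

theorem map_smul_bundleLaw (hz : IsTrajMap μ η L z) (g h : G) :
    (bundleLaw μ η z h).map (g • ·) = bundleLaw μ η z (g * h) := by
  rw [← hz.map_smul_bundleLaw_one h, ← hz.map_smul_bundleLaw_one (g * h),
    Measure.map_map (measurable_const_smul g) (measurable_const_smul h)]
  congr 1
  ext w : 1
  simp [mul_smul]

/-- The law from the identity is a mixture of the laws from all h with weights `stepLaw μ n {h}`;
for a suitable n the weight of g is positive. -/
theorem absolutelyContinuous (hμ : Nondegenerate μ) (hz : IsTrajMap μ η L z) (g : G) :
    bundleLaw μ η z g ≪ bundleLaw μ η z 1 := by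
  obtain ⟨n, hn⟩ := hμ.exists_stepLaw_ne_zero g
  refine Measure.AbsolutelyContinuous.mk fun E hE h0 => ?_
  rw [hz.bundleLaw_one_apply n hE, ENNReal.tsum_eq_zero] at h0
  exact (mul_eq_zero.1 (h0 g)).resolve_left hn

theorem absolutelyContinuous' (hμ : Nondegenerate μ) (hz : IsTrajMap μ η L z) (g : G) :
    bundleLaw μ η z 1 ≪ bundleLaw μ η z g := by
  have := (hz.absolutelyContinuous hμ g⁻¹).map (measurable_const_smul g)
  rwa [hz.map_smul_bundleLaw, hz.map_smul_bundleLaw, mul_inv_cancel, mul_one] at this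

theorem lintegral_density_mul (hμ : Nondegenerate μ) (hz : IsTrajMap μ η L z) (g : G)
    {F : X × Z → ℝ≥0∞} (hF : Measurable F) :
    ∫⁻ w, bundleDensity μ η z g w * F w ∂(bundleLaw μ η z 1) =
      ∫⁻ w, F w ∂(bundleLaw μ η z g) :=
  lintegral_rnDeriv_mul (hz.absolutelyContinuous hμ g) hF.aemeasurable

theorem density_pos (hμ : Nondegenerate μ) (hz : IsTrajMap μ η L z) (g : G) :
    ∀ᵐ w ∂(bundleLaw μ η z 1), 0 < bundleDensity μ η z g w :=
  Measure.rnDeriv_pos' (hz.absolutelyContinuous' hμ g)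

theorem density_lt_top (g : G) :
    ∀ᵐ w ∂(bundleLaw μ η z 1), bundleDensity μ η z g w < ∞ :=
  Measure.rnDeriv_lt_top _ _

end IsTrajMap

theorem ae_eq_of_forall_lintegral_mul_indicator {W : Type*} [MeasurableSpace W] {ν : Measure W}
    [SigmaFinite ν] {u v : W → ℝ≥0∞} (hu : Measurable u) (hv : Measurable v)
    (h : ∀ E, MeasurableSet E →
      ∫⁻ w, u w * E.indicator 1 w ∂ν = ∫⁻ w, v w * E.indicator 1 w ∂ν) : u =ᵐ[ν] v := by
  refine ae_eq_of_forall_setLIntegral_eq_of_sigmaFinite hu hv fun E hE _ => ?_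
  have e : ∀ (f : W → ℝ≥0∞) w, f w * E.indicator 1 w = E.indicator f w := fun f w => by
    by_cases hw : w ∈ E <;> simp [hw]
  have := h E hE
  simp_rw [e] at this
  rwa [lintegral_indicator hE, lintegral_indicator hE] at this

namespace IsTrajMap

variable [Countable G] [DiscreteMeasurableSpace G]
variable [MeasurableConstSMul G X] [MeasurableConstSMul G Z] [SMulInvariantMeasure G X η]

/-- The chain rule for densities: the law from g * h is the translate by g of the law from h. -/
theorem density_mul (hμ : Nondegenerate μ) (hz : IsTrajMap μ η L z) (g h : G) :
    ∀ᵐ w ∂(bundleLaw μ η z 1), bundleDensity μ η z (g * h) w =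
      bundleDensity μ η z g w * bundleDensity μ η z h (g⁻¹ • w) := by
  have hm : Measurable fun w => bundleDensity μ η z h (g⁻¹ • w) :=
    (measurable_bundleDensity μ η z h).comp (measurable_const_smul g⁻¹)
  refine ae_eq_of_forall_lintegral_mul_indicator (measurable_bundleDensity μ η z _)
    ((measurable_bundleDensity μ η z g).mul hm) fun E hE => ?_
  have hE1 : Measurable (E.indicator (1 : X × Z → ℝ≥0∞)) := measurable_one.indicator hE
  have hm2 : Measurable fun w => bundleDensity μ η z h (g⁻¹ • w) * E.indicator 1 w := hm.mul hE1
  simp_rw [mul_assoc]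
  rw [hz.lintegral_density_mul hμ _ hE1, hz.lintegral_density_mul hμ _ hm2,
    ← hz.map_smul_bundleLaw, ← hz.map_smul_bundleLaw_one g,
    lintegral_map hE1 (measurable_const_smul g),
    lintegral_map hm2 (measurable_const_smul g)]
  simp_rw [inv_smul_smul]
  exact (hz.lintegral_density_mul hμ h (F := fun a => E.indicator 1 (g • a))
    (hE1.comp (measurable_const_smul g))).symm

/-- The summands are the conditional probabilities of the positions at time n given the point of the
bundle, so their total is 1. -/
theorem tsum_stepLaw_mul_density (hμ : Nondegenerate μ) (hz : IsTrajMap μ η L z) (n : ℕ) :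
    ∀ᵐ w ∂(bundleLaw μ η z 1), ∑' g, stepLaw μ n {g} * bundleDensity μ η z g w = 1 := by
  have hm : ∀ g, Measurable fun w => stepLaw μ n {g} * bundleDensity μ η z g w := fun g =>
    (measurable_bundleDensity μ η z g).const_mul _
  refine ae_eq_of_forall_lintegral_mul_indicator (Measurable.tsum hm)
    measurable_const fun E hE => ?_
  have hE1 : Measurable (E.indicator (1 : X × Z → ℝ≥0∞)) := measurable_one.indicator hE
  simp_rw [one_mul, ← ENNReal.tsum_mul_right]
  have hm2 : ∀ g, Measurable fun w =>
      stepLaw μ n {g} * bundleDensity μ η z g w * E.indicator 1 w := fun g => (hm g).mul hE1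
  rw [lintegral_tsum fun g => (hm2 g).aemeasurable, lintegral_indicator_one hE,
    hz.bundleLaw_one_apply n hE]
  refine tsum_congr fun g => ?_
  simp_rw [mul_assoc]
  have hm3 : Measurable fun w => bundleDensity μ η z g w * E.indicator 1 w :=
    (measurable_bundleDensity μ η z g).mul hE1
  rw [lintegral_const_mul _ hm3,
    hz.lintegral_density_mul hμ g hE1, lintegral_indicator_one hE]

/-- Over the base points with l ∈ L_x, the trajectories from l * g and from g pass through the same
cosets. The two laws thus agree on that part of X × Z, which is why both densities are cut off to
it. -/
theorem density_coset (hμ : Nondegenerate μ) (hL : ∀ g : G, MeasurableSet {x : X | g ∈ L x})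
    (hz : IsTrajMap μ η L z) (l g : G) :
    ∀ᵐ w ∂(bundleLaw μ η z 1), l ∈ L w.1 →
      bundleDensity μ η z (l * g) w = bundleDensity μ η z g w := by
  set A : Set (X × Z) := {w | l ∈ L w.1} with hA
  have hAm : MeasurableSet A := measurable_fst (hL l)
  have h := ae_eq_of_forall_lintegral_mul_indicator (ν := bundleLaw μ η z 1)
    (u := A.indicator (bundleDensity μ η z (l * g))) (v := A.indicator (bundleDensity μ η z g))
    ((measurable_bundleDensity μ η z _).indicator hAm)
    ((measurable_bundleDensity μ η z _).indicator hAm) (by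
      intro E hE
      have e : ∀ (f : X × Z → ℝ≥0∞) w, A.indicator f w * E.indicator 1 w =
          f w * (A ∩ E).indicator 1 w := fun f w => by
        by_cases hw : w ∈ A <;> by_cases hw' : w ∈ E <;> simp [hw, hw']
      have hm : Measurable ((A ∩ E).indicator (1 : X × Z → ℝ≥0∞)) :=
        measurable_one.indicator (hAm.inter hE)
      simp_rw [e]
      rw [hz.lintegral_density_mul hμ _ hm, hz.lintegral_density_mul hμ _ hm,
        hz.lintegral_bundleLaw _ hm, hz.lintegral_bundleLaw _ hm]
      refine lintegral_congr fun y => ?_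
      by_cases hy : l ∈ L y.1
      · have := hz.coset g l y.1 y.2 hy
        rw [show z (l * g) y = z g y from this]
      · simp [indicator, hA, hy])
  filter_upwards [h] with w hw hl
  have hwA : w ∈ A := hl
  simpa [hwA] using hw

end IsTrajMap

end Trajectories

end PoissonBundle

/-! ### Logarithmic densities along the path -/

namespace PoissonBundle

open scoped ENNReal

section LogDensity

variable {G : Type*} [Group G] [MeasurableSpace G]
  {X : Type*} [MeasurableSpace X] [MulAction G X] {Z : Type*} [MeasurableSpace Z] [MulAction G Z]

/-- The logarithmic density along the first step of the trajectory. -/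
noncomputable def logDensity (μ : Measure G) (η : Measure X) (z : G → X × (ℕ → G) → Z)
    (y : X × (ℕ → G)) : ℝ :=
  Real.log (bundleDensity μ η z (y.2 0) (y.1, z 1 y)).toReal

variable {μ : Measure G} [IsProbabilityMeasure μ] {η : Measure X} [IsProbabilityMeasure η]
  {L : X → Subgroup G} {z : G → X × (ℕ → G) → Z}

/-- The hypothesis m r ≤ 1 bounds log r above by -log m, and log u ≤ u - 1 at u = r⁻¹ bounds -log r
by r⁻¹. Here m will be the μ-mass of a step and r its density. -/
theorem enorm_log_toReal_le {r : ℝ≥0∞} {m : ℝ} (hr0 : 0 < r) (hr : r < ∞) (hm0 : 0 < m)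
    (hm1 : m ≤ 1) (h : ENNReal.ofReal m * r ≤ 1) :
    ‖Real.log r.toReal‖ₑ ≤ ENNReal.ofReal (-Real.log m) + r⁻¹ := by
  lift r to NNReal using hr.ne
  have hr0' : (0 : ℝ) < r := by exact_mod_cast hr0
  have h' : m * r ≤ 1 := by
    have := ENNReal.toReal_mono ENNReal.one_ne_top h
    simpa [ENNReal.toReal_mul, hm0.le] using this
  have hlog : Real.log m + Real.log r ≤ 0 := by
    rw [← Real.log_mul hm0.ne' hr0'.ne']
    exact Real.log_nonpos (by positivity) h'
  have hinv : -Real.log r ≤ (r : ℝ)⁻¹ := by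
    rw [← Real.log_inv]
    have := Real.log_le_sub_one_of_pos (inv_pos.2 hr0')
    linarith
  have hm : 0 ≤ -Real.log m := neg_nonneg.2 (Real.log_nonpos hm0.le hm1)
  have hri : (0 : ℝ) ≤ (r : ℝ)⁻¹ := by positivity
  have e : ((r : ℝ≥0∞))⁻¹ = ENNReal.ofReal ((r : ℝ)⁻¹) := by
    rw [ENNReal.ofReal_inv_of_pos hr0', ENNReal.ofReal_coe_nnreal]
  rw [e, ← ENNReal.ofReal_add hm hri, ← ofReal_norm, Real.norm_eq_abs,
    ENNReal.coe_toReal]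
  exact ENNReal.ofReal_le_ofReal (abs_le.2 ⟨by linarith, by linarith⟩)

namespace IsTrajMap

variable [Countable G] [DiscreteMeasurableSpace G]

theorem measurable_density_comp (hz : IsTrajMap μ η L z) {a : X × (ℕ → G) → G}
    (ha : Measurable a) : Measurable fun y => bundleDensity μ η z (a y) (y.1, z 1 y) := by
  have h : Measurable fun p : G × X × Z => bundleDensity μ η z p.1 p.2 :=
    measurable_from_prod_countable_right fun g => measurable_bundleDensity μ η z g
  exact h.comp (ha.prodMk (hz.measurable_mk 1))

theorem measurable_logDensity (hz : IsTrajMap μ η L z) : Measurable (logDensity μ η z) :=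
  (hz.measurable_density_comp
    ((measurable_pi_apply 0).comp measurable_snd)).ennreal_toReal.log

theorem ae_of_ae_bundleLaw (hz : IsTrajMap μ η L z) {P : X × Z → Prop}
    (h : ∀ᵐ w ∂(bundleLaw μ η z 1), P w) : ∀ᵐ y ∂(η.prod (incLaw μ)), P (y.1, z 1 y) :=
  ae_of_ae_map (hz.measurable_mk 1).aemeasurable h

variable [MeasurableConstSMul G X] [MeasurableConstSMul G Z] [SMulInvariantMeasure G X η]

/-- Re-rooting the trajectory after one step translates the point of the bundle. This makes the
density cocycle a Birkhoff cocycle over `incShift`. -/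
theorem ae_step_smul (hz : IsTrajMap μ η L z) :
    ∀ᵐ y ∂(η.prod (incLaw μ)), z 1 (incShift y) = (y.2 0)⁻¹ • z 1 y := by
  have h1 : ∀ᵐ y ∂(η.prod (incLaw μ)), ∀ g : G, z g (g • y.1, y.2) = g • z 1 y :=
    ae_all_iff.2 hz.equivariant
  filter_upwards [(measurePreserving_incShift (μ := μ) (η := η)).quasiMeasurePreserving.ae h1]
    with y hy
  have h2 := hy (y.2 0)
  simp only [incShift, smul_inv_smul] at h2
  have h3 := hz.step 1 y.1 (y.2 0) (tailSeq y.2)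
  rw [consSeq_head_tail, one_mul] at h3
  rw [eq_inv_smul_iff]
  exact (h3.trans h2).symm

theorem log_density_walk (hμ : Nondegenerate μ) (hz : IsTrajMap μ η L z) (n : ℕ) :
    ∀ᵐ y ∂(η.prod (incLaw μ)),
      Real.log (bundleDensity μ η z (walk y.2 n) (y.1, z 1 y)).toReal =
        birkhoffSum incShift (logDensity μ η z) n y := by
  have hpos : ∀ᵐ y ∂(η.prod (incLaw μ)), ∀ g : G,
      (bundleDensity μ η z g (y.1, z 1 y)).toReal ≠ 0 :=
    ae_all_iff.2 fun g => by
      filter_upwards [hz.ae_of_ae_bundleLaw (hz.density_pos hμ g),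
        hz.ae_of_ae_bundleLaw (density_lt_top g)] with y h1 h2
      exact (ENNReal.toReal_pos h1.ne' h2.ne).ne'
  have hmp := (measurePreserving_incShift (μ := μ) (η := η)).quasiMeasurePreserving
  have hcoc : ∀ᵐ y ∂(η.prod (incLaw μ)), ∀ g h : G, bundleDensity μ η z (g * h) (y.1, z 1 y) =
      bundleDensity μ η z g (y.1, z 1 y) * bundleDensity μ η z h (g⁻¹ • (y.1, z 1 y)) :=
    ae_all_iff.2 fun g => ae_all_iff.2 fun h => hz.ae_of_ae_bundleLaw (hz.density_mul hμ g h)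
  induction n with
  | zero =>
    filter_upwards [hcoc, hpos] with y hy hy0
    -- The cocycle identity at (1, 1) says that the density at the identity equals its own square;
    -- being nonzero, it is 1.
    have h1 := hy 1 1
    have h2 := hy0 1
    rw [mul_one, inv_one, one_smul] at h1
    have h3 := congrArg ENNReal.toReal h1
    rw [ENNReal.toReal_mul] at h3
    have h4 : (bundleDensity μ η z 1 (y.1, z 1 y)).toReal = 1 := by
      field_simp at h3; linarith
    simp [walk, h4]
  | succ n ih =>
    filter_upwards [hcoc, hpos, hmp.ae hpos, hmp.ae ih, hz.ae_step_smul] with y h1 h2 h3 h4 h5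
    rw [birkhoffSum_succ', ← h4, walk_succ', h1]
    have h6 : (y.2 0)⁻¹ • (y.1, z 1 y) = ((incShift y).1, z 1 (incShift y)) := by
      rw [h5]; rfl
    rw [h6, ENNReal.toReal_mul, Real.log_mul (h2 _) (h3 _)]
    rfl

/-- Harmonicity gives μ(g) ρ_g ≤ 1, so the positive part of log ρ_g costs at most -log μ(g). The
negative part is at most ρ_g⁻¹, whose integral against ρ_g dΛ_1 is at most 1. Summation over the
first step bounds the norm by H(μ) + 1. -/
theorem integrable_logDensity (hμ : Nondegenerate μ) (hent : FiniteEntropy μ)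
    (hz : IsTrajMap μ η L z) : Integrable (logDensity μ η z) (η.prod (incLaw μ)) := by
  refine ⟨hz.measurable_logDensity.aestronglyMeasurable, ?_⟩
  have hm : ∀ g, Measurable fun w => ‖Real.log (bundleDensity μ η z g w).toReal‖ₑ := fun g =>
    (measurable_bundleDensity μ η z g).ennreal_toReal.log.enorm
  have h0 := hz.lintegral_head hm
  rw [hasFiniteIntegral_iff_enorm]
  refine (lt_of_eq_of_lt h0 ?_)
  have hb : ∀ g, μ {g} * ∫⁻ w, ‖Real.log (bundleDensity μ η z g w).toReal‖ₑ ∂(bundleLaw μ η z g) ≤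
      ENNReal.ofReal (Real.negMulLog (μ.real {g})) + μ {g} := by
    intro g
    by_cases hg : μ {g} = 0
    · simp [hg]
    have hg' : ENNReal.ofReal (μ.real {g}) = μ {g} := ofReal_measureReal
    have hgpos : 0 < μ.real {g} := ENNReal.toReal_pos hg (measure_ne_top _ _)
    have hac := hz.absolutelyContinuous hμ g
    have hsum := hz.tsum_stepLaw_mul_density hμ 1
    rw [stepLaw_one] at hsum
    have h1 : ∀ᵐ w ∂(bundleLaw μ η z g), ‖Real.log (bundleDensity μ η z g w).toReal‖ₑ ≤
        ENNReal.ofReal (-Real.log (μ.real {g})) + (bundleDensity μ η z g w)⁻¹ := by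
      filter_upwards [hac.ae_le (hz.density_pos hμ g), hac.ae_le (density_lt_top g),
        hac.ae_le hsum] with w hw1 hw2 hw3
      refine enorm_log_toReal_le hw1 hw2 hgpos measureReal_le_one ?_
      rw [hg', ← hw3]
      exact ENNReal.le_tsum g
    have h2 : ∫⁻ w, (bundleDensity μ η z g w)⁻¹ ∂(bundleLaw μ η z g) ≤ 1 := by
      rw [← hz.lintegral_density_mul hμ g (F := fun w => (bundleDensity μ η z g w)⁻¹)
        (measurable_bundleDensity μ η z g).inv]
      have := hz.isProbabilityMeasure 1
      calc _ ≤ ∫⁻ _, 1 ∂(bundleLaw μ η z 1) := lintegral_mono fun w => ENNReal.mul_inv_le_one _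
        _ = 1 := by simp
    have := hz.isProbabilityMeasure g
    calc _ ≤ μ {g} * ∫⁻ w, ENNReal.ofReal (-Real.log (μ.real {g})) + (bundleDensity μ η z g w)⁻¹
            ∂(bundleLaw μ η z g) := by gcongr 1; exact lintegral_mono_ae h1
      _ = μ {g} * (ENNReal.ofReal (-Real.log (μ.real {g})) +
            ∫⁻ w, (bundleDensity μ η z g w)⁻¹ ∂(bundleLaw μ η z g)) := by
          rw [lintegral_add_left measurable_const]; simp
      _ ≤ μ {g} * (ENNReal.ofReal (-Real.log (μ.real {g})) + 1) := by gcongr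
      _ = _ := by
          rw [mul_add, mul_one, ← hg', ← ENNReal.ofReal_mul hgpos.le, hg']
          congr 2
          rw [Real.negMulLog]; ring
  have hs1 : ∑' g, μ {g} = 1 := by
    have := lintegral_countable' (μ := μ) (fun _ => 1)
    simpa using this.symm
  calc _ ≤ ∑' g, (ENNReal.ofReal (Real.negMulLog (μ.real {g})) + μ {g}) :=
        ENNReal.tsum_le_tsum hb
    _ = ∑' g, ENNReal.ofReal (Real.negMulLog (μ.real {g})) + 1 := by rw [ENNReal.tsum_add, hs1]
    _ < ∞ := by
        rw [← ENNReal.ofReal_tsum_of_nonneg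
          (fun g => Real.negMulLog_nonneg measureReal_nonneg measureReal_le_one) hent]
        exact ENNReal.add_lt_top.2 ⟨ENNReal.ofReal_lt_top, ENNReal.one_lt_top⟩

end IsTrajMap

end LogDensity

end PoissonBundle

/-! ### Comparison of a bundle with a factor -/

namespace PoissonBundle

open scoped ENNReal

/-- The conditional expectation of a bounded function given `π`, as a function of `π`. -/
theorem exists_condExp_comp {W V : Type*} [MeasurableSpace W] [mV : MeasurableSpace V]
    {Λ : Measure W} [IsFiniteMeasure Λ] {π : W → V} (hπ : Measurable π) {F : W → ℝ}
    (hF : Measurable F) (hF1 : ∀ w, |F w| ≤ 1) :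
    ∃ φ : V → ℝ, Measurable φ ∧ (∀ᵐ w ∂Λ, |φ (π w)| ≤ 1) ∧
      ∀ u : V → ℝ, Measurable u → Integrable (fun w => u (π w)) Λ →
        ∫ w, F w * u (π w) ∂Λ = ∫ w, φ (π w) * u (π w) ∂Λ := by
  have hFi : Integrable F Λ :=
    Integrable.of_bound hF.aestronglyMeasurable 1 (Eventually.of_forall hF1)
  obtain ⟨φ, hφ, hφe⟩ := (stronglyMeasurable_condExp (μ := Λ) (m := mV.comap π)
    (f := F)).measurable.exists_eq_measurable_comp
  have hφπ : ∀ w, φ (π w) = (Λ[F | mV.comap π]) w := fun w => (congrFun hφe w).symm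
  refine ⟨φ, hφ, ?_, fun u hu hui => ?_⟩
  · simp_rw [hφπ]
    exact ae_bdd_abs_condExp_of_ae_bdd_abs (Eventually.of_forall hF1)
  · have hum : StronglyMeasurable[mV.comap π] fun w => u (π w) :=
      (hu.comp (comap_measurable π)).stronglyMeasurable
    have hFu : Integrable (F * fun w => u (π w)) Λ :=
      hui.bdd_mul (c := 1) hF.aestronglyMeasurable (Eventually.of_forall hF1)
    have h3 := integral_condExp hπ.comap_le (μ := Λ) (f := F * fun w => u (π w))
    rw [integral_congr_ae (condExp_mul_of_stronglyMeasurable_right hum hFu hFi)] at h3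
    simp only [Pi.mul_apply] at h3
    rw [← h3]
    simp_rw [hφπ]

section Factor

variable {G : Type*} [Group G] [MeasurableSpace G] [Countable G] [DiscreteMeasurableSpace G]
  {X : Type*} [MeasurableSpace X] [MulAction G X] [MeasurableConstSMul G X]
  {Z : Type*} [MeasurableSpace Z] [MulAction G Z] [MeasurableConstSMul G Z]
  {M : Type*} [MeasurableSpace M] [MulAction G M] [MeasurableConstSMul G M]
  {μ : Measure G} [IsProbabilityMeasure μ] {η : Measure X} [IsProbabilityMeasure η]
  {L : X → Subgroup G} {z : G → X × (ℕ → G) → Z} {p : Z → M}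

namespace IsTrajMap

theorem map_bundleLaw (hz : IsTrajMap μ η L z) (hp : Measurable p) (g : G) :
    (bundleLaw μ η z g).map (Prod.map id p) = bundleLaw μ η (fun g y => p (z g y)) g := by
  rw [bundleLaw, Measure.map_map (measurable_id.prodMap hp) (hz.measurable_mk g)]
  rfl

theorem ae_bundleLaw_of_factor (hz : IsTrajMap μ η L z) (hp : Measurable p) {g : G}
    {P : X × M → Prop} (h : ∀ᵐ v ∂(bundleLaw μ η (fun g y => p (z g y)) g), P v) :
    ∀ᵐ w ∂(bundleLaw μ η z g), P (w.1, p w.2) := by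
  rw [← hz.map_bundleLaw hp] at h
  exact ae_of_ae_map (measurable_id.prodMap hp).aemeasurable h

variable [SMulInvariantMeasure G X η]

/-- If a factor does not have a smaller mean logarithmic density, then it has the same density
along the first step. -/
theorem density_eq_of_integral_le (hμ : Nondegenerate μ) (hent : FiniteEntropy μ)
    (hz : IsTrajMap μ η L z) (hp : Measurable p)
    (hm : IsTrajMap μ η L fun g y => p (z g y))
    (hle : ∫ y, (logDensity μ η z y - logDensity μ η (fun g y => p (z g y)) y)
      ∂(η.prod (incLaw μ)) ≤ 0) {g : G} (hg : μ {g} ≠ 0) :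
    ∀ᵐ w ∂(bundleLaw μ η z 1), bundleDensity μ η z g w =
      bundleDensity μ η (fun g y => p (z g y)) g (w.1, p w.2) := by
  set m : G → X × (ℕ → G) → M := fun g y => p (z g y) with hmdef
  set D : X × (ℕ → G) → ℝ := fun y => logDensity μ η z y - logDensity μ η m y with hD
  have hDi : Integrable D (η.prod (incLaw μ)) :=
    (hz.integrable_logDensity hμ hent).sub (hm.integrable_logDensity hμ hent)
  have hρm : ∀ g, Measurable fun w : X × Z => bundleDensity μ η m g (w.1, p w.2) := fun g =>
    (measurable_bundleDensity μ η m g).comp (measurable_id.prodMap hp)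
  have hρz := measurable_bundleDensity μ η z
  have hfin : ∀ᵐ y ∂(η.prod (incLaw μ)), ∀ g : G, (0 < bundleDensity μ η z g (y.1, z 1 y) ∧
      bundleDensity μ η z g (y.1, z 1 y) < ∞) ∧ (0 < bundleDensity μ η m g (y.1, m 1 y) ∧
      bundleDensity μ η m g (y.1, m 1 y) < ∞) :=
    ae_all_iff.2 fun g => by
      filter_upwards [hz.ae_of_ae_bundleLaw (hz.density_pos hμ g),
        hz.ae_of_ae_bundleLaw (density_lt_top g), hm.ae_of_ae_bundleLaw (hm.density_pos hμ g),
        hm.ae_of_ae_bundleLaw (density_lt_top g)] with y h1 h2 h3 h4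
      exact ⟨⟨h1, h2⟩, h3, h4⟩
  -- Under the law from g the density of Z cancels the inverse, which leaves the integral of the
  -- density of M, equal to 1.
  have hR : ∫⁻ y, bundleDensity μ η m (y.2 0) (y.1, m 1 y) *
      (bundleDensity μ η z (y.2 0) (y.1, z 1 y))⁻¹ ∂(η.prod (incLaw μ)) ≤ 1 := by
    have h0 := hz.lintegral_head
      (F := fun g w => bundleDensity μ η m g (w.1, p w.2) * (bundleDensity μ η z g w)⁻¹)
      (fun g => (hρm g).mul (hρz g).inv)
    refine h0.trans_le ?_
    have hs1 : ∑' g, μ {g} = 1 := by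
      have := lintegral_countable' (μ := μ) (fun _ => 1)
      simpa using this.symm
    rw [← hs1]
    refine ENNReal.tsum_le_tsum fun g => ?_
    conv_rhs => rw [← mul_one (μ {g})]
    gcongr
    rw [← hz.lintegral_density_mul hμ g
      (F := fun w => bundleDensity μ η m g (w.1, p w.2) * (bundleDensity μ η z g w)⁻¹)
      ((hρm g).mul (hρz g).inv)]
    have := hm.isProbabilityMeasure g
    have hpm : Measurable (Prod.map (id : X → X) p) := measurable_id.prodMap hp
    calc _ ≤ ∫⁻ w, bundleDensity μ η m g (w.1, p w.2) ∂(bundleLaw μ η z 1) := by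
          refine lintegral_mono fun w => ?_
          rw [mul_left_comm]
          exact mul_le_of_le_one_right' (ENNReal.mul_inv_le_one _)
      _ = ∫⁻ v, bundleDensity μ η m g v ∂(bundleLaw μ η m 1) := by
          rw [hmdef, ← hz.map_bundleLaw hp,
            lintegral_map (measurable_bundleDensity μ η _ g) hpm]
          rfl
      _ = 1 := by
          have := hm.lintegral_density_mul hμ g (F := fun _ => 1) measurable_const
          simpa using this
  have hexp : ∀ᵐ y ∂(η.prod (incLaw μ)), Real.exp (-D y) =
      (bundleDensity μ η m (y.2 0) (y.1, m 1 y) *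
        (bundleDensity μ η z (y.2 0) (y.1, z 1 y))⁻¹).toReal := by
    filter_upwards [hfin] with y hy
    obtain ⟨⟨h1, h2⟩, h3, h4⟩ := hy (y.2 0)
    simp only [hD, logDensity, neg_sub]
    rw [Real.exp_sub, Real.exp_log (ENNReal.toReal_pos h3.ne' h4.ne),
      Real.exp_log (ENNReal.toReal_pos h1.ne' h2.ne), ENNReal.toReal_mul, ENNReal.toReal_inv]
    rfl
  have hRm : Measurable fun y : X × (ℕ → G) => bundleDensity μ η m (y.2 0) (y.1, m 1 y) *
      (bundleDensity μ η z (y.2 0) (y.1, z 1 y))⁻¹ :=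
    (hm.measurable_density_comp ((measurable_pi_apply 0).comp measurable_snd)).mul
      (hz.measurable_density_comp ((measurable_pi_apply 0).comp measurable_snd)).inv
  have hei : Integrable (fun y => Real.exp (-D y)) (η.prod (incLaw μ)) :=
    (integrable_toReal_of_lintegral_ne_top hRm.aemeasurable
      (hR.trans_lt ENNReal.one_lt_top).ne).congr (hexp.mono fun y hy => hy.symm)
  have hele : ∫ y, Real.exp (-D y) ∂(η.prod (incLaw μ)) ≤ 1 := by
    rw [integral_congr_ae hexp, integral_toReal hRm.aemeasurable
      (ae_lt_top hRm (hR.trans_lt ENNReal.one_lt_top).ne)]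
    exact ENNReal.toReal_mono ENNReal.one_ne_top hR
  -- The equality case of Jensen's inequality: exp(-D) - 1 + D is nonnegative and vanishes only at D
  -- = 0, while its integral is at most 0 since exp(-D) has mean at most 1 and D has mean at most 0.
  have hnn : ∀ y, 0 ≤ Real.exp (-D y) - 1 + D y := fun y => by
    have := Real.add_one_le_exp (-D y)
    linarith
  have hi1 : Integrable (fun y => Real.exp (-D y) - 1) (η.prod (incLaw μ)) :=
    hei.sub (integrable_const 1)
  have hi : Integrable (fun y => Real.exp (-D y) - 1 + D y) (η.prod (incLaw μ)) := hi1.add hDi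
  have hint0 : ∫ y, (Real.exp (-D y) - 1 + D y) ∂(η.prod (incLaw μ)) = 0 := by
    refine le_antisymm ?_ (integral_nonneg hnn)
    rw [integral_add hi1 hDi, integral_sub hei (integrable_const 1)]
    simp only [integral_const, probReal_univ, smul_eq_mul, mul_one]
    linarith
  have hD0 : ∀ᵐ y ∂(η.prod (incLaw μ)), D y = 0 := by
    filter_upwards [(integral_eq_zero_iff_of_nonneg hnn hi).1 hint0] with y hy
    by_contra hne
    have := Real.add_one_lt_exp (neg_ne_zero.2 hne)
    simp only [Pi.zero_apply] at hy
    linarith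
  have heq : ∀ᵐ y ∂(η.prod (incLaw μ)), bundleDensity μ η z (y.2 0) (y.1, z 1 y) =
      bundleDensity μ η m (y.2 0) (y.1, m 1 y) := by
    filter_upwards [hfin, hD0] with y hy hy0
    obtain ⟨⟨h1, h2⟩, h3, h4⟩ := hy (y.2 0)
    have h5 : Real.log _ = Real.log _ := sub_eq_zero.1 hy0
    exact (ENNReal.toReal_eq_toReal_iff' h2.ne h4.ne).1 (Real.log_injOn_pos
      (ENNReal.toReal_pos h1.ne' h2.ne) (ENNReal.toReal_pos h3.ne' h4.ne) h5)
  -- The equality holds along the random first step. Disintegrating over that step gives it at each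
  -- atom g of μ, for the law from g and then for the equivalent law from the identity.
  have hbad : ∀ g, MeasurableSet {w : X × Z | bundleDensity μ η z g w ≠
      bundleDensity μ η m g (w.1, p w.2)} := fun g =>
    (measurableSet_eq_fun (hρz g) (hρm g)).compl
  have h0 := hz.lintegral_head (F := fun g => {w : X × Z | bundleDensity μ η z g w ≠
      bundleDensity μ η m g (w.1, p w.2)}.indicator 1) fun g => measurable_one.indicator (hbad g)
  rw [lintegral_congr_ae (g := fun _ => 0) (by
    filter_upwards [heq] with y hy
    rw [indicator_of_notMem]
    exact fun h => h hy), lintegral_zero] at h0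
  have h1 := ENNReal.tsum_eq_zero.1 h0.symm g
  rw [mul_eq_zero, or_iff_right hg, lintegral_indicator_one (hbad g)] at h1
  exact (hz.absolutelyContinuous' hμ g).ae_le (ae_iff.2 h1)

theorem ae_map_smul (hz : IsTrajMap μ η L z) (hp : Measurable p)
    (hm : IsTrajMap μ η L fun g y => p (z g y)) [MeasurableEq M] (g : G) :
    ∀ᵐ w ∂(bundleLaw μ η z 1), p (g • w.2) = g • p w.2 := by
  have hms : MeasurableSet {w : X × Z | p (g • w.2) = g • p w.2} :=
    measurableSet_eq_fun (hp.comp ((measurable_const_smul g).comp measurable_snd))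
      ((measurable_const_smul g).comp (hp.comp measurable_snd))
  rw [bundleLaw, ae_map_iff (hz.measurable_mk 1).aemeasurable hms]
  filter_upwards [hz.equivariant g, hm.equivariant g] with y h1 h2
  rw [← h1, h2]

/-- Both sides satisfy the same cocycle identity, so equality spreads from the support of μ to the
semigroup that it generates. -/
theorem density_eq (hμ : Nondegenerate μ) (hz : IsTrajMap μ η L z) (hp : Measurable p)
    (hm : IsTrajMap μ η L fun g y => p (z g y)) [MeasurableEq M]
    (h : ∀ g, μ {g} ≠ 0 → ∀ᵐ w ∂(bundleLaw μ η z 1), bundleDensity μ η z g w =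
      bundleDensity μ η (fun g y => p (z g y)) g (w.1, p w.2)) (g : G) :
    ∀ᵐ w ∂(bundleLaw μ η z 1), bundleDensity μ η z g w =
      bundleDensity μ η (fun g y => p (z g y)) g (w.1, p w.2) := by
  have hg : g ∈ Subsemigroup.closure {g : G | μ {g} ≠ 0} := by rw [hμ]; trivial
  induction hg using Subsemigroup.closure_induction with
  | mem g hg => exact h g hg
  | mul g k _ _ hg hk =>
    have hk' : ∀ᵐ w ∂(bundleLaw μ η z 1), bundleDensity μ η z k (g⁻¹ • w) =
        bundleDensity μ η (fun g y => p (z g y)) k ((g⁻¹ • w).1, p (g⁻¹ • w).2) := by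
      have h0 := (hz.absolutelyContinuous hμ g⁻¹).ae_le hk
      rw [← hz.map_smul_bundleLaw_one] at h0
      exact ae_of_ae_map (measurable_const_smul g⁻¹).aemeasurable h0
    filter_upwards [hz.density_mul hμ g k, hg, hk', hz.ae_map_smul hp hm g⁻¹,
      hz.ae_bundleLaw_of_factor hp (hm.density_mul hμ g k)] with w h1 h2 h3 h4 h5
    rw [h1, h2, h3, h5]
    congr 2
    exact Prod.ext rfl h4

/-- If the densities of a bundle agree with those of a factor, then the factor determines the
bundle. -/
theorem exists_factor_of_density_eq (hμ : Nondegenerate μ) (hz : IsTrajMap μ η L z)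
    (hp : Measurable p)
    (h : ∀ g, ∀ᵐ w ∂(bundleLaw μ η z 1), bundleDensity μ η z g w =
      bundleDensity μ η (fun g y => p (z g y)) g (w.1, p w.2))
    {F : Z → ℝ} (hF : Measurable F) (hF1 : ∀ w, |F w| ≤ 1) :
    ∃ φ : X × M → ℝ, Measurable φ ∧ ∀ᵐ w ∂(bundleLaw μ η z 1), F w.2 = φ (w.1, p w.2) := by
  set m : G → X × (ℕ → G) → M := fun g y => p (z g y) with hmdef
  set π : X × Z → X × M := Prod.map id p with hπ
  have hπm : Measurable π := measurable_id.prodMap hp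
  set Λ := bundleLaw μ η z 1 with hΛ
  have hF2m : Measurable fun w : X × Z => F w.2 := hF.comp measurable_snd
  obtain ⟨φ, hφ, hφ1, hφu⟩ := exists_condExp_comp (Λ := Λ) hπm hF2m fun w => hF1 w.2
  refine ⟨φ, hφ, ?_⟩
  have hfm : Measurable fun w : X × Z => F w.2 - φ (π w) := hF2m.sub (hφ.comp hπm)
  have hfi : ∀ g, Integrable (fun w : X × Z => F w.2 - φ (π w)) (bundleLaw μ η z g) := fun g =>
    Integrable.of_bound hfm.aestronglyMeasurable (1 + 1) (by
      filter_upwards [(hz.absolutelyContinuous hμ g).ae_le hφ1] with w hw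
      exact (norm_sub_le _ _).trans (add_le_add (hF1 _) hw))
  -- The function F - φ ∘ π, evaluated on the trajectories from all starting points, is a consistent
  -- family; it remains to integrate it over subsets of the base.
  have hzero := ae_eq_zero_of_forall_base_integral_eq_zero (μ := μ) (η := η)
    (f := fun g y => F (z g y) - φ (π (y.1, z g y)))
    (fun g => (integrable_map_measure hfm.aestronglyMeasurable
      (hz.measurable_mk g).aemeasurable).1 (hfi g))
    (fun g x k s => by simp only [hz.step])
    (by
      intro g A hA
      have hA' : MeasurableSet (Prod.fst ⁻¹' A : Set (X × Z)) := measurable_fst hA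
      have e1 : ∫ y in Prod.fst ⁻¹' A, (F (z g y) - φ (π (y.1, z g y))) ∂(η.prod (incLaw μ)) =
          ∫ w in Prod.fst ⁻¹' A, (F w.2 - φ (π w)) ∂(bundleLaw μ η z g) := by
        rw [bundleLaw, setIntegral_map hA' hfm.aestronglyMeasurable
          (hz.measurable_mk g).aemeasurable]
        rfl
      set v : X × M → ℝ := (Prod.fst ⁻¹' A).indicator
        (fun v : X × M => (bundleDensity μ η m g v).toReal) with hv
      have hvm : Measurable v :=
        (measurable_bundleDensity μ η m g).ennreal_toReal.indicator (measurable_fst hA)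
      have hui : Integrable (fun w => v (π w)) Λ := by
        have : Integrable v (bundleLaw μ η m 1) :=
          Measure.integrable_toReal_rnDeriv.indicator (measurable_fst hA)
        rw [hmdef, ← hz.map_bundleLaw hp] at this
        exact this.comp_measurable hπm
      have hFu : Integrable (fun w => F w.2 * v (π w)) Λ :=
        hui.bdd_mul (c := 1) hF2m.aestronglyMeasurable (Eventually.of_forall fun w => hF1 _)
      have hφv : Integrable (fun w => φ (π w) * v (π w)) Λ :=
        hui.bdd_mul (c := 1) (hφ.comp hπm).aestronglyMeasurable hφ1
      -- The hypothesis makes the change of density to the law from the identity a function of π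
      -- alone, so the defining property of the conditional expectation φ applies with v as test
      -- function.
      have e3 : ∫ w in Prod.fst ⁻¹' A, (F w.2 - φ (π w)) ∂(bundleLaw μ η z g) =
          ∫ w, (F w.2 * v (π w) - φ (π w) * v (π w)) ∂Λ := by
        rw [← integral_indicator hA', ← integral_rnDeriv_smul (hz.absolutelyContinuous hμ g)]
        refine integral_congr_ae ?_
        filter_upwards [h g] with w hw
        change (bundleDensity μ η z g w).toReal • _ = _
        rw [hw]
        by_cases hwA : w.1 ∈ A
        · have h1 : w ∈ (Prod.fst ⁻¹' A : Set (X × Z)) := hwA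
          have h2 : π w ∈ (Prod.fst ⁻¹' A : Set (X × M)) := hwA
          rw [hv]
          simp only [indicator_of_mem h1, indicator_of_mem h2, smul_eq_mul]
          change (bundleDensity μ η m g (π w)).toReal * _ = _
          ring
        · have h1 : w ∉ (Prod.fst ⁻¹' A : Set (X × Z)) := hwA
          have h2 : π w ∉ (Prod.fst ⁻¹' A : Set (X × M)) := hwA
          rw [hv]
          simp only [indicator_of_notMem h1, indicator_of_notMem h2, smul_eq_mul]
          ring
      rw [e1, e3, integral_sub hFu hφv, hφu v hvm hui, sub_self]) 1
  have hms : MeasurableSet {w : X × Z | F w.2 = φ (w.1, p w.2)} :=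
    measurableSet_eq_fun hF2m (hφ.comp hπm)
  rw [hΛ, bundleLaw, ae_map_iff (hz.measurable_mk 1).aemeasurable hms]
  filter_upwards [hzero] with y hy
  exact sub_eq_zero.1 hy

end IsTrajMap

end Factor

end PoissonBundle

/-! ### Counting cosets; measurability of lengths and cardinalities -/

namespace PoissonBundle

open scoped ENNReal

section CosetCount

variable {G : Type*} [Group G]

theorem coset_eq_iff (H : Subgroup G) (g h : G) :
    coset H g = coset H h ↔ h * g⁻¹ ∈ H := by
  rw [coset, coset, Quotient.eq]
  exact QuotientGroup.rightRel_apply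

/-- A subset all of whose elements have a bounded number of predecessors is bounded in size. -/
theorem encard_le_of_forall_encard_le {C : Type*} (S : Set C) (len : C → ℝ) (K : ℕ) :
    {a | a ∈ S ∧ (S ∩ {b | len b ≤ len a}).encard ≤ K}.encard ≤ K := by
  by_contra hlt
  push Not at hlt
  -- Among K + 1 such elements, the one of greatest length has all K + 1 of them among its
  -- predecessors.
  obtain ⟨F, hFs, hF⟩ := Set.exists_subset_encard_eq (Order.add_one_le_of_lt hlt)
  have hfin : F.Finite := Set.finite_of_encard_eq_coe (k := K + 1) (by rw [hF]; rfl)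
  have hne : F.Nonempty := by
    rw [← Set.encard_ne_zero, hF]; simp
  obtain ⟨a, ha, hmax⟩ := Set.exists_max_image F len hfin hne
  have h1 : F ⊆ S ∩ {b | len b ≤ len a} := fun b hb => ⟨(hFs hb).1, hmax b hb⟩
  have h2 := (Set.encard_le_encard h1).trans (hFs ha).2
  rw [hF] at h2
  exact absurd h2 (not_le.2 (by exact_mod_cast Nat.lt_succ_self K))

/-- The mass of the coset of `g`. -/
noncomputable def cosetMass (H : Subgroup G) (a : G → ℝ≥0∞) (g : G) : ℝ≥0∞ :=
  ∑' h, {h | coset H h = coset H g}.indicator a h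

/-- Since r is constant on cosets, the sum can be grouped by coset. At most K cosets satisfy the
first two conditions, and each contributes its mass times r, which is at most δ. -/
theorem tsum_indicator_coset_le (H : Subgroup G) (a r : G → ℝ≥0∞)
    (hr : ∀ l ∈ H, ∀ g, r (l * g) = r g) (S : Set (CosetSpace H)) (len : CosetSpace H → ℝ) (K : ℕ)
    (δ : ℝ≥0∞) :
    ∑' g, a g * (r g * {g | coset H g ∈ S ∧
      (S ∩ {b | len b ≤ len (coset H g)}).encard ≤ K ∧ cosetMass H a g * r g ≤ δ}.indicator 1 g) ≤
      K * δ := by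
  classical
  have hr' : ∀ g h, coset H h = coset H g → r h = r g := fun g h hgh => by
    have := hr _ ((coset_eq_iff H g h).1 hgh.symm) g
    rwa [inv_mul_cancel_right] at this
  set A : Set (CosetSpace H) := {c | c ∈ S ∧ (S ∩ {b | len b ≤ len c}).encard ≤ K} with hA
  rw [← ENNReal.tsum_fiberwise _ (coset H)]
  have hfib : ∀ c, ∑' g : coset H ⁻¹' {c}, a g * (r g * {g | coset H g ∈ S ∧
      (S ∩ {b | len b ≤ len (coset H g)}).encard ≤ K ∧ cosetMass H a g * r g ≤ δ}.indicator 1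
        (g : G)) ≤ A.indicator (fun _ => δ) c := by
    intro c
    obtain ⟨g₀, rfl⟩ := Quotient.exists_rep c
    change ∑' g : coset H ⁻¹' {coset H g₀}, _ ≤ A.indicator (fun _ => δ) (coset H g₀)
    have hmem : ∀ g : coset H ⁻¹' {coset H g₀}, coset H (g : G) = coset H g₀ := fun g => g.2
    have hmass : ∀ g : coset H ⁻¹' {coset H g₀}, cosetMass H a g = cosetMass H a g₀ := fun g => by
      simp only [cosetMass, hmem g]
    by_cases hc : (coset H g₀ ∈ S ∧ (S ∩ {b | len b ≤ len (coset H g₀)}).encard ≤ K ∧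
        cosetMass H a g₀ * r g₀ ≤ δ)
    · have hcA : coset H g₀ ∈ A := ⟨hc.1, hc.2.1⟩
      rw [indicator_of_mem hcA]
      refine le_trans (le_of_eq ?_) hc.2.2
      have hcm : cosetMass H a g₀ = ∑' g : coset H ⁻¹' {coset H g₀}, a g :=
        (tsum_subtype (coset H ⁻¹' {coset H g₀}) a).symm
      rw [hcm, ← ENNReal.tsum_mul_right]
      refine tsum_congr fun g => ?_
      rw [indicator_of_mem, Pi.one_apply, mul_one, hr' _ _ (hmem g)]
      simp only [mem_ofPred_eq, hmem g, hmass g, hr' _ _ (hmem g)]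
      exact hc
    · refine (ENNReal.tsum_eq_zero.2 fun g => ?_).le.trans zero_le
      rw [indicator_of_notMem, mul_zero, mul_zero]
      simp only [mem_ofPred_eq, hmem g, hmass g, hr' _ _ (hmem g)]
      exact hc
  refine (ENNReal.tsum_le_tsum hfib).trans ?_
  rw [← tsum_subtype, ENNReal.tsum_const]
  gcongr
  have := encard_le_of_forall_encard_le S len K
  exact_mod_cast this

end CosetCount

section Measurability

variable {G : Type*} [Group G] [Countable G] [MetricSpace G] {X : Type*} [MeasurableSpace X]
  {L : X → Subgroup G}

theorem measurableSet_coset_eq (hL : ∀ g : G, MeasurableSet {x : X | g ∈ L x}) (g h : G) :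
    MeasurableSet {x : X | coset (L x) g = coset (L x) h} := by
  simp_rw [coset_eq_iff]
  exact hL _

theorem measurable_cosetMass (hL : ∀ g : G, MeasurableSet {x : X | g ∈ L x}) (a : G → ℝ≥0∞)
    (g : G) : Measurable fun x => cosetMass (L x) a g := by
  refine Measurable.tsum fun h => ?_
  have : (fun x => {h | coset (L x) h = coset (L x) g}.indicator a h) =
      {x | coset (L x) h = coset (L x) g}.indicator fun _ => a h := by
    ext x; rfl
  rw [this]
  exact measurable_const.indicator (measurableSet_coset_eq hL h g)

theorem measurable_cosetLength (hL : ∀ g : G, MeasurableSet {x : X | g ∈ L x}) (g : G) :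
    Measurable fun x => cosetLength (L x) (coset (L x) g) := by
  refine measurable_of_Iio fun r => ?_
  have : (fun x => cosetLength (L x) (coset (L x) g)) ⁻¹' Iio r =
      ⋃ (k : G) (h : G), {x | coset (L x) k = coset (L x) 1 ∧ coset (L x) h = coset (L x) g ∧
        dist k h < r} := by
    ext x
    simp only [mem_preimage, mem_Iio, mem_iUnion, mem_ofPred_eq, cosetLength, cosetDist]
    have hb : BddBelow {r : ℝ | ∃ k h : G, coset (L x) k = coset (L x) 1 ∧
        coset (L x) h = coset (L x) g ∧ dist k h = r} :=
      ⟨0, by rintro _ ⟨_, _, _, _, rfl⟩; exact dist_nonneg⟩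
    have hne : {r : ℝ | ∃ k h : G, coset (L x) k = coset (L x) 1 ∧
        coset (L x) h = coset (L x) g ∧ dist k h = r}.Nonempty := ⟨_, 1, g, rfl, rfl, rfl⟩
    rw [csInf_lt_iff hb hne]
    constructor
    · rintro ⟨_, ⟨k, h, hk, hh, rfl⟩, hlt⟩
      exact ⟨k, h, hk, hh, hlt⟩
    · rintro ⟨k, h, hk, hh, hlt⟩
      exact ⟨_, ⟨k, h, hk, hh, rfl⟩, hlt⟩
  rw [this]
  refine MeasurableSet.iUnion fun k => MeasurableSet.iUnion fun h => ?_
  exact (measurableSet_coset_eq hL k 1).inter ((measurableSet_coset_eq hL h g).inter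
    (MeasurableSet.const _))

/-- Having more than K elements is witnessed by K + 1 group elements whose cosets are distinct and
lie in the set; there are countably many candidate families. -/
theorem measurableSet_encard_le {W : Type*} [MeasurableSpace W] {π : W → X} (hπ : Measurable π)
    (hL : ∀ g : G, MeasurableSet {x : X | g ∈ L x}) {S : (w : W) → Set (CosetSpace (L (π w)))}
    (hS : ∀ g, MeasurableSet {w | coset (L (π w)) g ∈ S w}) (K : ℕ) :
    MeasurableSet {w | (S w).encard ≤ K} := by
  have : {w | (S w).encard ≤ K} = (⋃ (F : Finset G) (_ : F.card = K + 1),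
      (⋂ (g : G) (_ : g ∈ F), {w | coset (L (π w)) g ∈ S w}) ∩
      ⋂ (g : G) (_ : g ∈ F) (h : G) (_ : h ∈ F) (_ : g ≠ h),
        {w | coset (L (π w)) g = coset (L (π w)) h}ᶜ)ᶜ := by
    ext w
    rw [mem_compl_iff, mem_ofPred_eq, ← not_lt, not_iff_not]
    simp only [mem_iUnion, mem_inter_iff, mem_iInter, mem_compl_iff, mem_ofPred_eq]
    constructor
    · intro hlt
      obtain ⟨T, hTs, hT⟩ := Set.exists_subset_encard_eq (Order.add_one_le_of_lt hlt)
      have hfin : T.Finite := Set.finite_of_encard_eq_coe (k := K + 1) (by rw [hT]; rfl)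
      classical
      have hinj : Function.Injective (Quotient.out : CosetSpace (L (π w)) → G) :=
        Quotient.out_injective
      refine ⟨hfin.toFinset.image Quotient.out, ?_, ?_, ?_⟩
      · rw [Finset.card_image_of_injective _ hinj]
        have h1 := hfin.encard_eq_coe_toFinset_card
        rw [hT] at h1
        exact_mod_cast h1.symm
      · intro g hg
        obtain ⟨c, hc, rfl⟩ := Finset.mem_image.1 hg
        rw [coset, Quotient.out_eq]
        exact hTs (hfin.mem_toFinset.1 hc)
      · intro g hg h hh hne heq
        obtain ⟨c, hc, rfl⟩ := Finset.mem_image.1 hg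
        obtain ⟨d, hd, rfl⟩ := Finset.mem_image.1 hh
        rw [coset, coset, Quotient.out_eq, Quotient.out_eq] at heq
        exact hne (by rw [heq])
    · rintro ⟨F, hF, hFS, hFinj⟩
      have hsub : (coset (L (π w)) '' (F : Set G)) ⊆ S w := by
        rintro _ ⟨g, hg, rfl⟩; exact hFS g hg
      have hio : InjOn (coset (L (π w))) (F : Set G) := fun g hg h hh heq => by
        by_contra hne
        exact hFinj g hg h hh hne heq
      have := Set.encard_le_encard hsub
      rw [hio.encard_image, Set.encard_coe_eq_coe_finsetCard, hF] at this
      refine lt_of_lt_of_le ?_ this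
      exact_mod_cast Nat.lt_succ_self K
  rw [this]
  refine MeasurableSet.compl (MeasurableSet.iUnion fun F => MeasurableSet.iUnion fun _ =>
    MeasurableSet.inter (MeasurableSet.iInter fun g => MeasurableSet.iInter fun _ => hS g) ?_)
  exact MeasurableSet.iInter fun g => MeasurableSet.iInter fun _ => MeasurableSet.iInter fun h =>
    MeasurableSet.iInter fun _ => MeasurableSet.iInter fun _ =>
      (hπ (measurableSet_coset_eq hL g h)).compl

end Measurability

end PoissonBundle

/-! ### Strips of subexponential size rule out an entropy gap -/

namespace PoissonBundle

open scoped ENNReal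

section Strips

variable {G : Type*} [Group G] [MeasurableSpace G] [Countable G] [DiscreteMeasurableSpace G]
  [MetricSpace G]
  {X : Type*} [MeasurableSpace X] [MulAction G X] [MeasurableConstSMul G X]
  {M : Type*} [MeasurableSpace M] [MulAction G M] [MeasurableConstSMul G M]
  {μ : Measure G} [IsProbabilityMeasure μ] {η : Measure X} [IsProbabilityMeasure η]
  {L : X → Subgroup G} {m : G → X × (ℕ → G) → M}
  {T : Type*} [MeasurableSpace T] {τ : Measure T} [IsProbabilityMeasure τ]
  {strip : (w : X × M) → T → Set (CosetSpace (L w.1))}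

/-- The part of the strip that is not further from the root than the coset of `g`. -/
def stripBall (strip : (w : X × M) → T → Set (CosetSpace (L w.1))) (q : (X × M) × T) (g : G) :
    Set (CosetSpace (L q.1.1)) :=
  strip q.1 q.2 ∩ cosetBall (L q.1.1) (cosetLength (L q.1.1) (coset (L q.1.1) g))

/-- The event that the coset of `g` lies in the strip, that the strip is small up to this coset and
that the conditional probability of this coset at time `n` is small. -/
def sparseEvent (μ : Measure G) (η : Measure X) (m : G → X × (ℕ → G) → M)
    (strip : (w : X × M) → T → Set (CosetSpace (L w.1))) (n K : ℕ) (δ : ℝ≥0∞) (g : G) :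
    Set ((X × M) × T) :=
  {q | coset (L q.1.1) g ∈ strip q.1 q.2 ∧ (stripBall strip q g).encard ≤ K ∧
    cosetMass (L q.1.1) (fun h => stepLaw μ n {h}) g * bundleDensity μ η m g q.1 ≤ δ}

theorem measurableSet_stripBall_encard_le (hL : ∀ g : G, MeasurableSet {x : X | g ∈ L x})
    (hstrip : ∀ g, MeasurableSet {q : (X × M) × T | coset (L q.1.1) g ∈ strip q.1 q.2})
    (g : G) (K : ℕ) : MeasurableSet {q | (stripBall strip q g).encard ≤ K} := by
  have hπ : Measurable fun q : (X × M) × T => q.1.1 := measurable_fst.comp measurable_fst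
  refine measurableSet_encard_le hπ hL (fun h => (hstrip h).inter ?_) K
  exact measurableSet_le ((measurable_cosetLength hL h).comp hπ)
    ((measurable_cosetLength hL g).comp hπ)

theorem measurableSet_mass_mul_density_le (hL : ∀ g : G, MeasurableSet {x : X | g ∈ L x})
    (n : ℕ) (δ : ℝ≥0∞) (g : G) :
    MeasurableSet {w : X × M |
      cosetMass (L w.1) (fun h => stepLaw μ n {h}) g * bundleDensity μ η m g w ≤ δ} :=
  measurableSet_le (((measurable_cosetMass hL _ g).comp measurable_fst).mul
    (measurable_bundleDensity μ η m g)) measurable_const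

theorem measurableSet_sparseEvent (hL : ∀ g : G, MeasurableSet {x : X | g ∈ L x})
    (hstrip : ∀ g, MeasurableSet {q : (X × M) × T | coset (L q.1.1) g ∈ strip q.1 q.2})
    (n K : ℕ) (δ : ℝ≥0∞) (g : G) : MeasurableSet (sparseEvent μ η m strip n K δ g) :=
  (hstrip g).inter ((measurableSet_stripBall_encard_le hL hstrip g K).inter
    (measurable_fst (measurableSet_mass_mul_density_le hL n δ g)))

theorem measurableSet_comp_walk (hm : IsTrajMap μ η L m) {A : G → Set ((X × M) × T)}
    (hA : ∀ g, MeasurableSet (A g)) (n : ℕ) :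
    MeasurableSet {q : (X × (ℕ → G)) × T | ((q.1.1, m 1 q.1), q.2) ∈ A (walk q.1.2 n)} := by
  have h1 : MeasurableSet {r : G × (X × M) × T | r.2 ∈ A r.1} := by
    have : {r : G × (X × M) × T | r.2 ∈ A r.1} = ⋃ g, {g} ×ˢ A g := by
      ext ⟨g, q⟩; simp
    rw [this]
    exact MeasurableSet.iUnion fun g => (measurableSet_singleton g).prod (hA g)
  have h2 : Measurable fun q : (X × (ℕ → G)) × T =>
      ((walk q.1.2 n, ((q.1.1, m 1 q.1), q.2)) : G × (X × M) × T) :=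
    ((measurable_walk_apply n).comp (measurable_snd.comp measurable_fst)).prodMk
      (((hm.measurable_mk 1).comp measurable_fst).prodMk measurable_snd)
  exact h2 h1

variable [SMulInvariantMeasure G X η]

/-- Given the point w and the independent parameter t, the strip is a fixed set. The conditional
probability of the event is then a sum over at most K cosets, each of conditional probability at
most δ. -/
theorem measure_sparseEvent_le (hμ : Nondegenerate μ)
    (hL : ∀ g : G, MeasurableSet {x : X | g ∈ L x}) (hm : IsTrajMap μ η L m)
    (hstrip : ∀ g, MeasurableSet {q : (X × M) × T | coset (L q.1.1) g ∈ strip q.1 q.2})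
    (n K : ℕ) (δ : ℝ≥0∞) :
    ((η.prod (incLaw μ)).prod τ) {q : (X × (ℕ → G)) × T |
      ((q.1.1, m 1 q.1), q.2) ∈ sparseEvent μ η m strip n K δ (walk q.1.2 n)} ≤ K * δ := by
  have hA := measurableSet_sparseEvent (μ := μ) (η := η) (m := m) hL hstrip n K δ
  set A : G → Set ((X × M) × T) := sparseEvent μ η m strip n K δ with hAdef
  rw [Measure.prod_apply (measurableSet_comp_walk hm hA n)]
  have hF : ∀ g, Measurable fun w : X × M => τ {t | (w, t) ∈ A g} := fun g =>
    measurable_measure_prodMk_left (hA g)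
  have h0 := hm.lintegral_walk n hF
  refine h0.trans_le ?_
  have hρ := measurable_bundleDensity μ η m
  have e1 : ∀ g, ∫⁻ w, τ {t | (w, t) ∈ A g} ∂(bundleLaw μ η m g) =
      ∫⁻ w, bundleDensity μ η m g w * τ {t | (w, t) ∈ A g} ∂(bundleLaw μ η m 1) := fun g =>
    (hm.lintegral_density_mul hμ g (hF g)).symm
  simp_rw [e1]
  have hmg : ∀ g, Measurable fun w => bundleDensity μ η m g w * τ {t | (w, t) ∈ A g} := fun g =>
    (hρ g).mul (hF g)
  have e2 : ∀ g, stepLaw μ n {g} *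
      ∫⁻ w, bundleDensity μ η m g w * τ {t | (w, t) ∈ A g} ∂(bundleLaw μ η m 1) =
      ∫⁻ w, stepLaw μ n {g} * (bundleDensity μ η m g w * τ {t | (w, t) ∈ A g})
        ∂(bundleLaw μ η m 1) := fun g => (lintegral_const_mul _ (hmg g)).symm
  simp_rw [e2]
  rw [← lintegral_tsum fun g => ((hmg g).const_mul _).aemeasurable]
  have hcos : ∀ᵐ w ∂(bundleLaw μ η m 1), ∀ l g, l ∈ L w.1 →
      bundleDensity μ η m (l * g) w = bundleDensity μ η m g w :=
    ae_all_iff.2 fun l => ae_all_iff.2 fun g => hm.density_coset hμ hL l g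
  have := hm.isProbabilityMeasure 1
  refine (lintegral_mono_ae (g := fun _ => K * δ) ?_).trans (by simp)
  filter_upwards [hcos] with w hw
  have hAt : ∀ g, MeasurableSet {t | (w, t) ∈ A g} := fun g => measurable_prodMk_left (hA g)
  have e3 : ∀ g, stepLaw μ n {g} * (bundleDensity μ η m g w * τ {t | (w, t) ∈ A g}) =
      ∫⁻ t, stepLaw μ n {g} * (bundleDensity μ η m g w * {t | (w, t) ∈ A g}.indicator 1 t) ∂τ := by
    intro g
    have hi : Measurable ({t | (w, t) ∈ A g}.indicator (1 : T → ℝ≥0∞)) :=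
      measurable_one.indicator (hAt g)
    rw [lintegral_const_mul _ (hi.const_mul _), lintegral_const_mul _ hi,
      lintegral_indicator_one (hAt g)]
  simp_rw [e3]
  rw [← lintegral_tsum fun g =>
    (((measurable_one.indicator (hAt g)).const_mul _).const_mul _).aemeasurable]
  refine (lintegral_mono (g := fun _ => K * δ) fun t => ?_).trans (by simp)
  exact tsum_indicator_coset_le (L w.1) (fun h => stepLaw μ n {h})
    (fun g => bundleDensity μ η m g w) (fun l hl g => hw l g hl) (strip w t)
    (cosetLength (L w.1)) K δ

/-- The product is the part of the total conditional probability 1 that is carried by a single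
coset. -/
theorem cosetMass_mul_density_le_one (hμ : Nondegenerate μ)
    (hL : ∀ g : G, MeasurableSet {x : X | g ∈ L x}) (hm : IsTrajMap μ η L m) (n : ℕ) :
    ∀ᵐ w ∂(bundleLaw μ η m 1), ∀ g,
      cosetMass (L w.1) (fun h => stepLaw μ n {h}) g * bundleDensity μ η m g w ≤ 1 := by
  have hcos : ∀ᵐ w ∂(bundleLaw μ η m 1), ∀ l g, l ∈ L w.1 →
      bundleDensity μ η m (l * g) w = bundleDensity μ η m g w :=
    ae_all_iff.2 fun l => ae_all_iff.2 fun g => hm.density_coset hμ hL l g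
  filter_upwards [hcos, hm.tsum_stepLaw_mul_density hμ n] with w h1 h2 g
  rw [← h2, cosetMass, ← ENNReal.tsum_mul_right]
  refine ENNReal.tsum_le_tsum fun h => ?_
  by_cases hh : coset (L w.1) h = coset (L w.1) g
  · have h3 := h1 _ g ((coset_eq_iff _ g h).1 hh.symm)
    rw [inv_mul_cancel_right] at h3
    rw [indicator_of_mem (show h ∈ {h | coset (L w.1) h = coset (L w.1) g} from hh), h3]
  · rw [indicator_of_notMem (show h ∉ {h | coset (L w.1) h = coset (L w.1) g} from hh), zero_mul]
    exact zero_le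

end Strips

theorem le_floor_of_coe_le_ofReal {N : ℕ∞} {r : ℝ} (hr : 0 ≤ r)
    (h : (N : ℝ≥0∞) ≤ ENNReal.ofReal r) : N ≤ (⌊r⌋₊ : ℕ) := by
  have hN : N ≠ ⊤ := by
    rintro rfl
    exact absurd h (by simp)
  lift N to ℕ using hN
  have h1 : (N : ℝ≥0∞) ≤ ENNReal.ofReal r := by exact_mod_cast h
  rw [← ENNReal.ofReal_natCast, ENNReal.ofReal_le_ofReal_iff hr] at h1
  exact_mod_cast Nat.le_floor h1

section Core

variable {G : Type*} [Group G] [MeasurableSpace G] [Countable G] [DiscreteMeasurableSpace G]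
  [MetricSpace G]
  {X : Type*} [MeasurableSpace X] [MulAction G X] [MeasurableConstSMul G X]
  {Z : Type*} [MeasurableSpace Z] [MulAction G Z] [MeasurableConstSMul G Z]
  {M : Type*} [MeasurableSpace M] [MulAction G M] [MeasurableConstSMul G M]
  {μ : Measure G} [IsProbabilityMeasure μ] {η : Measure X} [IsProbabilityMeasure η]
  [ErgodicSMul G X η]
  {L : X → Subgroup G} {z : G → X × (ℕ → G) → Z} {p : Z → M}
  {T : Type*} [MeasurableSpace T] {τ : Measure T} [IsProbabilityMeasure τ]
  {strip : (w : X × M) → T → Set (CosetSpace (L w.1))}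

/-- For the bundle the product of mass and density is at most 1. By the ergodic estimate, replacing
its density by that of the factor gains exp(-cn) along the path. -/
theorem eventually_mass_mul_density_le (hμ : Nondegenerate μ) (hent : FiniteEntropy μ)
    (hL : ∀ g : G, MeasurableSet {x : X | g ∈ L x})
    (hz : IsTrajMap μ η L z) (hm : IsTrajMap μ η L fun g y => p (z g y)) {c : ℝ}
    (hc : c < ∫ y, (logDensity μ η z y - logDensity μ η (fun g y => p (z g y)) y)
      ∂(η.prod (incLaw μ))) :
    ∀ᵐ y ∂(η.prod (incLaw μ)), ∀ᶠ n : ℕ in atTop,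
      cosetMass (L y.1) (fun h => stepLaw μ n {h}) (walk y.2 n) *
        bundleDensity μ η (fun g y => p (z g y)) (walk y.2 n) (y.1, p (z 1 y)) ≤
        ENNReal.ofReal (Real.exp (-(c * n))) := by
  have hb := eventually_lt_birkhoffSum (ergodic_incShift (μ := μ) (η := η) hμ)
    (hz.measurable_logDensity.sub hm.measurable_logDensity)
    ((hz.integrable_logDensity hμ hent).sub (hm.integrable_logDensity hμ hent)) hc
  have hfin : ∀ᵐ y ∂(η.prod (incLaw μ)), ∀ g : G, (0 < bundleDensity μ η z g (y.1, z 1 y) ∧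
      bundleDensity μ η z g (y.1, z 1 y) < ∞) ∧
      (0 < bundleDensity μ η (fun g y => p (z g y)) g (y.1, p (z 1 y)) ∧
      bundleDensity μ η (fun g y => p (z g y)) g (y.1, p (z 1 y)) < ∞) :=
    ae_all_iff.2 fun g => by
      filter_upwards [hz.ae_of_ae_bundleLaw (hz.density_pos hμ g),
        hz.ae_of_ae_bundleLaw (IsTrajMap.density_lt_top g),
        hm.ae_of_ae_bundleLaw (hm.density_pos hμ g),
        hm.ae_of_ae_bundleLaw (IsTrajMap.density_lt_top g)] with y h1 h2 h3 h4
      exact ⟨⟨h1, h2⟩, h3, h4⟩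
  have hone : ∀ᵐ y ∂(η.prod (incLaw μ)), ∀ (n : ℕ) (g : G),
      cosetMass (L y.1) (fun h => stepLaw μ n {h}) g * bundleDensity μ η z g (y.1, z 1 y) ≤ 1 :=
    ae_all_iff.2 fun n => hz.ae_of_ae_bundleLaw (cosetMass_mul_density_le_one hμ hL hz n)
  filter_upwards [hb, hfin, hone, ae_all_iff.2 fun n => hz.log_density_walk hμ n,
    ae_all_iff.2 fun n => hm.log_density_walk hμ n] with y h1 h2 h3 h4 h5
  filter_upwards [h1] with n hn
  obtain ⟨⟨a1, a2⟩, a3, a4⟩ := h2 (walk y.2 n)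
  have e : birkhoffSum incShift (logDensity μ η z - logDensity μ η fun g y => p (z g y)) n y =
      birkhoffSum incShift (logDensity μ η z) n y -
      birkhoffSum incShift (logDensity μ η fun g y => p (z g y)) n y := by
    simp [birkhoffSum]
  rw [e, ← h4 n, ← h5 n] at hn
  set r := bundleDensity μ η z (walk y.2 n) (y.1, z 1 y) with hr
  set r' := bundleDensity μ η (fun g y => p (z g y)) (walk y.2 n) (y.1, p (z 1 y)) with hr'
  have hle : r' ≤ r * ENNReal.ofReal (Real.exp (-(c * n))) := by
    rw [← ENNReal.ofReal_toReal a2.ne, ← ENNReal.ofReal_toReal a4.ne,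
      ← ENNReal.ofReal_mul ENNReal.toReal_nonneg]
    refine ENNReal.ofReal_le_ofReal ?_
    have b1 := ENNReal.toReal_pos a1.ne' a2.ne
    have b2 := ENNReal.toReal_pos a3.ne' a4.ne
    rw [← Real.log_le_log_iff b2 (by positivity), Real.log_mul b1.ne' (Real.exp_pos _).ne',
      Real.log_exp]
    linarith
  calc _ ≤ cosetMass (L y.1) (fun h => stepLaw μ n {h}) (walk y.2 n) *
        (r * ENNReal.ofReal (Real.exp (-(c * n)))) := by gcongr
    _ = cosetMass (L y.1) (fun h => stepLaw μ n {h}) (walk y.2 n) * r *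
        ENNReal.ofReal (Real.exp (-(c * n))) := by rw [mul_assoc]
    _ ≤ 1 * ENNReal.ofReal (Real.exp (-(c * n))) := by gcongr; exact h3 n _
    _ = _ := one_mul _

/-- If the trajectory lies in strips of subexponential size with a probability that is bounded
below, then the mean logarithmic densities of the bundle and of its factor agree. -/
theorem integral_logDensity_sub_nonpos_of_strip (hμ : Nondegenerate μ) (hent : FiniteEntropy μ)
    (hL : ∀ g : G, MeasurableSet {x : X | g ∈ L x})
    (hz : IsTrajMap μ η L z) (hm : IsTrajMap μ η L fun g y => p (z g y))
    (hstrip : ∀ g, MeasurableSet {q : (X × M) × T | coset (L q.1.1) g ∈ strip q.1 q.2})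
    {a : ℝ≥0∞} (ha : a ≠ 0)
    (hroot : ∀ n, a ≤ ((η.prod (incLaw μ)).prod τ) {q : (X × (ℕ → G)) × T |
      coset (L q.1.1) (walk q.1.2 n) ∈ strip (q.1.1, p (z 1 q.1)) q.2})
    (hgrowth : ∀ ε : ℝ, 0 < ε → ∀ᵐ q ∂((η.prod (incLaw μ)).prod τ), ∀ᶠ n : ℕ in atTop,
      ((stripBall strip ((q.1.1, p (z 1 q.1)), q.2) (walk q.1.2 n)).encard : ℝ≥0∞) ≤
        ENNReal.ofReal (Real.exp (ε * n))) :
    ∫ y, (logDensity μ η z y - logDensity μ η (fun g y => p (z g y)) y)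
      ∂(η.prod (incLaw μ)) ≤ 0 := by
  by_contra hpos
  push Not at hpos
  obtain ⟨c, hc0, hc⟩ := exists_between hpos
  set m : G → X × (ℕ → G) → M := fun g y => p (z g y) with hmdef
  -- Growth at half the rate c of the decay leaves K n * δ n ≤ exp(-cn/2).
  set K : ℕ → ℕ := fun n => ⌊Real.exp (c / 2 * n)⌋₊ with hK
  set δ : ℕ → ℝ≥0∞ := fun n => ENNReal.ofReal (Real.exp (-(c * n))) with hδ
  set Q := (η.prod (incLaw μ)).prod τ with hQ
  set good : ℕ → G → Set ((X × M) × T) := fun n g => {q | (stripBall strip q g).encard ≤ K n ∧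
    cosetMass (L q.1.1) (fun h => stepLaw μ n {h}) g * bundleDensity μ η m g q.1 ≤ δ n} with hgood
  have hgm : ∀ n g, MeasurableSet (good n g) := fun n g =>
    (measurableSet_stripBall_encard_le hL hstrip g (K n)).inter
      (measurable_fst (measurableSet_mass_mul_density_le hL n (δ n) g))
  set bad : ℕ → Set ((X × (ℕ → G)) × T) := fun n =>
    {q | ((q.1.1, m 1 q.1), q.2) ∈ good n (walk q.1.2 n)}ᶜ with hbad
  have hbm : ∀ n, MeasurableSet (bad n) := fun n =>
    (measurableSet_comp_walk hm (hgm n) n).compl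
  -- Almost every point leaves the bad sets eventually, so their probabilities tend to 0 by
  -- dominated convergence.
  have hev : ∀ᵐ q ∂Q, ∀ᶠ n in atTop, q ∈ bad n ↔ q ∈ (∅ : Set ((X × (ℕ → G)) × T)) := by
    have h1 := eventually_mass_mul_density_le hμ hent hL hz hm hc
    have h2 : ∀ᵐ q ∂Q, ∀ᶠ n : ℕ in atTop,
        cosetMass (L q.1.1) (fun h => stepLaw μ n {h}) (walk q.1.2 n) *
          bundleDensity μ η m (walk q.1.2 n) (q.1.1, m 1 q.1) ≤ δ n :=
      Measure.quasiMeasurePreserving_fst.ae h1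
    filter_upwards [h2, hgrowth (c / 2) (by linarith)] with q h3 h4
    filter_upwards [h3, h4] with n h5 h6
    simp only [hbad, mem_empty_iff_false, iff_false, not_not, mem_compl_iff]
    exact ⟨le_floor_of_coe_le_ofReal (Real.exp_pos _).le h6, h5⟩
  have hbt : Tendsto (fun n => Q (bad n)) atTop (nhds (Q ∅)) :=
    tendsto_measure_of_ae_tendsto_indicator_of_isFiniteMeasure atTop MeasurableSet.empty hbm hev
  rw [measure_empty] at hbt
  have hdt : Tendsto (fun n : ℕ => (K n : ℝ≥0∞) * δ n) atTop (nhds 0) := by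
    have h1 : Tendsto (fun n : ℕ => ENNReal.ofReal (Real.exp (-(c / 2 * n)))) atTop (nhds 0) := by
      rw [← ENNReal.ofReal_zero]
      refine ENNReal.tendsto_ofReal (Real.tendsto_exp_atBot.comp ?_)
      exact tendsto_neg_atTop_atBot.comp
        (tendsto_natCast_atTop_atTop.const_mul_atTop (by linarith))
    refine tendsto_of_tendsto_of_tendsto_of_le_of_le tendsto_const_nhds h1 (fun _ => zero_le)
      fun n => ?_
    have h2 : (K n : ℝ≥0∞) ≤ ENNReal.ofReal (Real.exp (c / 2 * n)) := by
      rw [← ENNReal.ofReal_natCast]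
      exact ENNReal.ofReal_le_ofReal (Nat.floor_le (Real.exp_pos _).le)
    calc (K n : ℝ≥0∞) * δ n ≤ ENNReal.ofReal (Real.exp (c / 2 * n)) * δ n := by gcongr
      _ = _ := by
        rw [hδ, ← ENNReal.ofReal_mul (Real.exp_pos _).le, ← Real.exp_add]
        congr 2; ring
  -- If the path lies in the strip, then either the sparse event or the bad event occurs; both have
  -- vanishing probability.
  have hle : ∀ n, a ≤ K n * δ n + Q (bad n) := by
    intro n
    refine (hroot n).trans ?_
    refine le_trans ?_ (add_le_add_left
      (measure_sparseEvent_le (τ := τ) hμ hL hm hstrip n (K n) (δ n)) _)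
    refine (measure_mono ?_).trans (measure_union_le _ _)
    intro q hq
    by_cases hqb : q ∈ bad n
    · exact Or.inr hqb
    · left
      have : ((q.1.1, m 1 q.1), q.2) ∈ good n (walk q.1.2 n) := not_not.1 hqb
      exact ⟨hq, this.1, this.2⟩
  have hlim := ge_of_tendsto' (hdt.add hbt) hle
  simp only [add_zero, nonpos_iff_eq_zero] at hlim
  exact ha hlim

end Core

end PoissonBundle

/-! ### From equal densities to an isomorphism of bundles -/

namespace PoissonBundle

open scoped ENNReal

section Isomorphism

variable {G : Type*} [Group G] {A B : Type*} [MeasurableSpace A] [StandardBorelSpace A]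
  [MulAction G A] [MeasurableConstSMul G A] [MeasurableSpace B] [StandardBorelSpace B]
  [MulAction G B] [MeasurableConstSMul G B] {α : Measure A} {β : Measure B}

/-- An almost sure left inverse suffices: every property required of r on B is checked after pulling
back by f. Quasi-invariance of α lets the inversion identity be used at g • a as well. -/
theorem IsFactorMap.isIsomorphism {f : A → B} (hf : IsFactorMap G f α β)
    (hqi : ∀ g : G, α.map (g • ·) ≪ α) {r : B → A} (hr : Measurable r)
    (hrf : ∀ᵐ a ∂α, r (f a) = a) : IsIsomorphism G f α β := by
  have hfm := hf.measurePreserving.measurable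
  have hpull : ∀ {P : B → Prop}, MeasurableSet {b | P b} → (∀ᵐ a ∂α, P (f a)) → ∀ᵐ b ∂β, P b := by
    intro P hP h
    rw [← hf.measurePreserving.map_eq]
    exact (ae_map_iff hfm.aemeasurable hP).2 h
  refine ⟨hf, r, ⟨⟨hr, ?_⟩, fun g => ?_⟩, hrf, ?_⟩
  · rw [← hf.measurePreserving.map_eq, Measure.map_map hr hfm]
    conv_rhs => rw [← Measure.map_id (μ := α)]
    exact Measure.map_congr hrf
  · refine hpull (measurableSet_eq_fun (hr.comp (measurable_const_smul g))
      ((measurable_const_smul g).comp hr)) ?_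
    have h1 : ∀ᵐ a ∂α, r (f (g • a)) = g • a :=
      ae_of_ae_map (measurable_const_smul g).aemeasurable ((hqi g).ae_le hrf)
    filter_upwards [h1, hrf, hf.equivariant g] with a h2 h3 h4
    rw [← h4, h2, h3]
  · refine hpull (measurableSet_eq_fun (hfm.comp hr) measurable_id) ?_
    filter_upwards [hrf] with a h
    rw [h]

end Isomorphism

section TrajPoint

variable {G X Z : Type*} [Group G] {L : X → Subgroup G}

/-- The point of the bundle determined by the trajectory that starts at `g`. -/
def trajPoint (θ : CosetTraj L → Z) (g : G) (y : X × (ℕ → G)) : Z :=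
  θ (toCosetTraj L (y.1, fun n => g * walk y.2 n))

theorem trajPoint_one (θ : CosetTraj L → Z) (y : X × (ℕ → G)) :
    trajPoint θ 1 y = θ (toCosetTraj L (y.1, walk y.2)) := by
  simp [trajPoint]

end TrajPoint

section Bundle

variable {G : Type*} [Group G] [MeasurableSpace G] [Countable G] [DiscreteMeasurableSpace G]
  {X : Type*} [MeasurableSpace X] [MulAction G X] [MeasurableConstSMul G X]
  {Z : Type*} [MeasurableSpace Z] [MulAction G Z] [MeasurableConstSMul G Z]
  {M : Type*} [MeasurableSpace M] [MulAction G M] [MeasurableConstSMul G M]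
  {μ : Measure G} [IsProbabilityMeasure μ] {η : Measure X} [IsProbabilityMeasure η]
  {L : X → Subgroup G} {lam : Measure Z} {θ : CosetTraj L → Z} {κ : Measure M} {p : Z → M}
  {q : M → X}

theorem measurePreserving_walk (μ : Measure G) [IsProbabilityMeasure μ] (η : Measure X)
    [IsProbabilityMeasure η] :
    MeasurePreserving (fun y : X × (ℕ → G) => (y.1, walk y.2)) (η.prod (incLaw μ))
      (η.prod (pathLaw μ)) :=
  (MeasurePreserving.id η).prod ⟨measurable_walk, rfl⟩

theorem IsPoissonBundle.measurable (hZ : IsPoissonBundle μ η L lam θ) : Measurable θ :=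
  hZ.measurable_invariants.mono (MeasurableSpace.invariants_le _) le_rfl

theorem IsPoissonBundle.isTrajMap [MeasurableSingletonClass Z]
    (hZ : IsPoissonBundle μ η L lam θ) : IsTrajMap μ η L (trajPoint θ) where
  measurable g := by
    refine hZ.measurable.comp ((measurable_toCosetTraj L).comp (measurable_fst.prodMk ?_))
    refine measurable_pi_lambda _ fun n => ?_
    exact (measurable_of_countable (g * ·)).comp ((measurable_walk_apply n).comp measurable_snd)
  step g x h s := by
    -- Measurability with respect to the invariant sets gives exact shift invariance, so the step
    -- identity holds everywhere and not just almost everywhere.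
    have h1 : θ ∘ shift L = θ :=
      MeasurableSpace.comp_eq_of_measurable_invariants hZ.measurable_invariants
    rw [trajPoint, ← congrFun h1, trajPoint, Function.comp]
    congr 1
    refine congrArg (Sigma.mk x) (funext fun n => ?_)
    change coset (L x) (g * walk (consSeq h s) (n + 1)) = coset (L x) (g * h * walk s n)
    rw [walk_succ', ← mul_assoc]
    rfl
  equivariant g := by
    filter_upwards [(measurePreserving_walk μ η).quasiMeasurePreserving.ae (hZ.equivariant g)]
      with y hy
    rw [trajPoint_one]
    exact hy
  coset g l x s hl := by
    rw [trajPoint, trajPoint]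
    congr 1
    refine congrArg (Sigma.mk x) (funext fun n => ?_)
    change coset (L x) (l * g * walk s n) = coset (L x) (g * walk s n)
    rw [coset_eq_iff]
    have : g * walk s n * (l * g * walk s n)⁻¹ = l⁻¹ := by group
    rw [this]
    exact inv_mem hl

theorem IsPoissonBundle.map_trajPoint (hZ : IsPoissonBundle μ η L lam θ) :
    (η.prod (incLaw μ)).map (trajPoint θ 1) = lam := by
  rw [← hZ.map_eq, cosetTrajLaw, ← (measurePreserving_walk μ η).map_eq,
    Measure.map_map (measurable_toCosetTraj L) (measurePreserving_walk μ η).measurable,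
    Measure.map_map hZ.measurable ((measurable_toCosetTraj L).comp
      (measurePreserving_walk μ η).measurable)]
  congr 1
  ext y
  exact trajPoint_one θ y

theorem IsPoissonBundle.map_snd_bundleLaw [MeasurableSingletonClass Z]
    (hZ : IsPoissonBundle μ η L lam θ) :
    (bundleLaw μ η (trajPoint θ) 1).map Prod.snd = lam := by
  rw [bundleLaw, Measure.map_map measurable_snd (hZ.isTrajMap.measurable_mk 1),
    ← hZ.map_trajPoint]
  rfl

theorem IsPoissonBundle.map_smul_absolutelyContinuous [MeasurableSingletonClass Z]
    [SMulInvariantMeasure G X η] (hμ : Nondegenerate μ)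
    (hZ : IsPoissonBundle μ η L lam θ) (g : G) : lam.map (g • ·) ≪ lam := by
  have h := ((hZ.isTrajMap.absolutelyContinuous hμ g).map measurable_snd)
  rw [← hZ.isTrajMap.map_smul_bundleLaw_one,
    Measure.map_map measurable_snd (measurable_const_smul g), hZ.map_snd_bundleLaw] at h
  rw [← hZ.map_snd_bundleLaw, Measure.map_map (measurable_const_smul g) measurable_snd,
    hZ.map_snd_bundleLaw]
  exact h

theorem IsIntermediate.isTrajMap [MeasurableSingletonClass Z]
    (hZ : IsPoissonBundle μ η L lam θ) (hM : IsIntermediate μ η L lam θ κ p q) :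
    IsTrajMap μ η L fun g y => p (trajPoint θ g y) where
  measurable g := hM.factor_left.measurePreserving.measurable.comp (hZ.isTrajMap.measurable g)
  step g x h s := by rw [hZ.isTrajMap.step]
  equivariant g := by
    have h := hM.factor_left.equivariant g
    rw [← hZ.map_trajPoint] at h
    filter_upwards [hZ.isTrajMap.equivariant g,
      ae_of_ae_map (hZ.isTrajMap.measurable 1).aemeasurable h] with y h1 h2
    rw [h1, h2]
  coset g l x s hl := by rw [hZ.isTrajMap.coset g l x s hl]

theorem IsIntermediate.ae_proj [MeasurableSingletonClass Z]
    (hM : IsIntermediate μ η L lam θ κ p q) :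
    ∀ᵐ y ∂(η.prod (incLaw μ)), q (p (trajPoint θ 1 y)) = y.1 := by
  have h := ae_of_ae_map (measurable_toCosetTraj L).aemeasurable hM.proj
  filter_upwards [(measurePreserving_walk μ η).quasiMeasurePreserving.ae h] with y hy
  rw [trajPoint_one, hy]
  rfl

/-- An intermediate factor of the Poisson bundle admitting strips of subexponential size that
contain the trajectory with a probability bounded below is isomorphic to the bundle. -/
theorem IsIntermediate.isIsomorphism_of_strip [MetricSpace G] [StandardBorelSpace Z]
    [StandardBorelSpace M] [ErgodicSMul G X η] (hμ : Nondegenerate μ) (hent : FiniteEntropy μ)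
    (hL : ∀ g : G, MeasurableSet {x : X | g ∈ L x})
    (hZ : IsPoissonBundle μ η L lam θ) (hM : IsIntermediate μ η L lam θ κ p q)
    {T : Type*} [MeasurableSpace T] {τ : Measure T} [IsProbabilityMeasure τ]
    {strip : (w : X × M) → T → Set (CosetSpace (L w.1))}
    (hstrip : ∀ g, MeasurableSet {q : (X × M) × T | coset (L q.1.1) g ∈ strip q.1 q.2})
    {a : ℝ≥0∞} (ha : a ≠ 0)
    (hroot : ∀ n, a ≤ ((η.prod (incLaw μ)).prod τ) {q : (X × (ℕ → G)) × T |
      coset (L q.1.1) (walk q.1.2 n) ∈ strip (q.1.1, p (trajPoint θ 1 q.1)) q.2})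
    (hgrowth : ∀ ε : ℝ, 0 < ε → ∀ᵐ q ∂((η.prod (incLaw μ)).prod τ), ∀ᶠ n : ℕ in atTop,
      ((stripBall strip ((q.1.1, p (trajPoint θ 1 q.1)), q.2) (walk q.1.2 n)).encard : ℝ≥0∞) ≤
        ENNReal.ofReal (Real.exp (ε * n))) :
    IsIsomorphism G p lam κ := by
  have hz := hZ.isTrajMap
  have hm := hM.isTrajMap hZ
  have hp : Measurable p := hM.factor_left.measurePreserving.measurable
  have hq : Measurable q := hM.factor_right.measurePreserving.measurable
  have hle := integral_logDensity_sub_nonpos_of_strip hμ hent hL hz hm hstrip ha hroot hgrowth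
  have hdens := hz.density_eq hμ hp hm fun g hg => hz.density_eq_of_integral_le hμ hent hp hm hle hg
  -- An embedding of Z in [0, 1] is one bounded function that separates the points of Z; recovering
  -- it from M recovers Z.
  have he : MeasurableEmbedding fun w : Z => ((unitInterval.sigmoid (embeddingReal Z w)) : ℝ) :=
    (MeasurableEmbedding.subtype_coe measurableSet_Icc).comp
      (measurableEmbedding_sigmoid_comp_embeddingReal Z)
  set e : Z → ℝ := fun w => ((unitInterval.sigmoid (embeddingReal Z w)) : ℝ) with hedef
  have he1 : ∀ w, |e w| ≤ 1 := fun w => by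
    rw [abs_of_nonneg (unitInterval.sigmoid (embeddingReal Z w)).2.1]
    exact (unitInterval.sigmoid (embeddingReal Z w)).2.2
  obtain ⟨φ, hφ, hφe⟩ := hz.exists_factor_of_density_eq hμ hp hdens he.measurable he1
  have hprob : IsProbabilityMeasure (bundleLaw μ η (trajPoint θ) 1) := hz.isProbabilityMeasure 1
  obtain ⟨w₀⟩ : Nonempty (X × Z) :=
    nonempty_of_isProbabilityMeasure (bundleLaw μ η (trajPoint θ) 1)
  obtain ⟨r₀, hr₀, hr₀e⟩ := he.exists_measurable_extend measurable_id fun _ => ⟨w₀.2⟩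
  refine hM.factor_left.isIsomorphism (hZ.map_smul_absolutelyContinuous hμ)
    (r := fun b => r₀ (φ (q b, b))) (hr₀.comp (hφ.comp (hq.prodMk measurable_id))) ?_
  have hms : MeasurableSet {w : Z | r₀ (φ (q (p w), p w)) = w} :=
    measurableSet_eq_fun (hr₀.comp (hφ.comp ((hq.comp hp).prodMk hp))) measurable_id
  rw [← hZ.map_trajPoint, ae_map_iff (hz.measurable 1).aemeasurable hms]
  filter_upwards [hz.ae_of_ae_bundleLaw hφe, hM.ae_proj] with y h1 h2
  -- The recovery function φ also needs the base point, which the projection q reads off the point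
  -- of M.
  rw [h2]
  rw [← h1]
  exact congrFun hr₀e _

end Bundle

end PoissonBundle

/-! ### The bilateral path and its shift -/

namespace PoissonBundle

open scoped ENNReal

section Bilateral

variable {G : Type*} [Group G] [MeasurableSpace G] [Countable G] [DiscreteMeasurableSpace G]
  {X : Type*} [MeasurableSpace X] [MulAction G X] [MeasurableConstSMul G X]
  {M : Type*} [MeasurableSpace M] [MulAction G M] [MeasurableConstSMul G M]
  {N : Type*} [MeasurableSpace N] [MulAction G N] [MeasurableConstSMul G N]
  {μ ν : Measure G} [IsProbabilityMeasure μ] [IsProbabilityMeasure ν]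
  {η : Measure X} [IsProbabilityMeasure η] {L : X → Subgroup G}
  {m : G → X × (ℕ → G) → M} {m' : G → X × (ℕ → G) → N}

/-- The bilateral shift in terms of the increments of the two halves of the path. -/
def biShift (q : (X × (ℕ → G)) × (ℕ → G)) : (X × (ℕ → G)) × (ℕ → G) :=
  (incShift q.1, consSeq (q.1.2 0)⁻¹ q.2)

/-- The law of the base point and of the increments of the two halves of the path. -/
noncomputable def biLaw (μ ν : Measure G) (η : Measure X) : Measure ((X × (ℕ → G)) × (ℕ → G)) :=
  (η.prod (incLaw μ)).prod (incLaw ν)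

instance : IsProbabilityMeasure (biLaw μ ν η) := by unfold biLaw; infer_instance

theorem measurable_biShift :
    Measurable (biShift : (X × (ℕ → G)) × (ℕ → G) → (X × (ℕ → G)) × (ℕ → G)) :=
  (measurable_incShift.comp measurable_fst).prodMk (measurable_consSeq.comp
    (((measurable_of_countable fun g : G => g⁻¹).comp ((measurable_pi_apply 0).comp
      (measurable_snd.comp measurable_fst))).prodMk measurable_snd))

/-- The shift takes the first positive increment, of law μ, and puts its inverse, of law ν, in front
of the negative half. Conditionally on this increment, the base point is moved by an η-preserving
map and the rest is unchanged. -/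
theorem measurePreserving_biShift [SMulInvariantMeasure G X η] (hν : ν = μ.inv) :
    MeasurePreserving biShift (biLaw μ ν η) (biLaw μ ν η) := by
  have h1 : MeasurePreserving
      (fun p : G × (X × (ℕ → G)) × (ℕ → G) => ((p.2.1.1, consSeq p.1 p.2.1.2), p.2.2))
      (μ.prod (biLaw μ ν η)) (biLaw μ ν η) :=
    ((measurePreserving_cons μ η).prod (MeasurePreserving.id (incLaw ν))).comp
      (measurePreserving_prodAssoc μ (η.prod (incLaw μ)) (incLaw ν)).symm
  have h3 : MeasurePreserving
      (fun p : G × (X × (ℕ → G)) × (ℕ → G) => (p.1, ((p.1⁻¹ • p.2.1.1, p.2.1.2), p.2.2)))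
      (μ.prod (biLaw μ ν η)) (μ.prod (biLaw μ ν η)) := by
    refine (MeasurePreserving.id μ).skew_product
      (g := fun (g : G) (q : (X × (ℕ → G)) × (ℕ → G)) => ((g⁻¹ • q.1.1, q.1.2), q.2)) ?_ (Eventually.of_forall fun g => ?_)
    · exact measurable_from_prod_countable_right fun g =>
        ((((measurable_const_smul g⁻¹).comp (measurable_fst.comp measurable_fst)).prodMk
          (measurable_snd.comp measurable_fst)).prodMk measurable_snd)
    · exact (((measurePreserving_smul g⁻¹ η).prod (MeasurePreserving.id (incLaw μ))).prod
        (MeasurePreserving.id (incLaw ν))).map_eq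
  have h4 : MeasurePreserving (fun p : G × (X × (ℕ → G)) × (ℕ → G) => (p.1⁻¹, p.2))
      (μ.prod (biLaw μ ν η)) (ν.prod (biLaw μ ν η)) := by
    have : MeasurePreserving (fun g : G => g⁻¹) μ ν :=
      ⟨measurable_of_countable _, by rw [hν]; rfl⟩
    exact this.prod (MeasurePreserving.id (biLaw μ ν η))
  have h5 := ((measurePreserving_cons ν (η.prod (incLaw μ))).comp h4).comp h3
  refine ⟨measurable_biShift, ?_⟩
  conv_lhs => rw [← h1.map_eq]
  rw [Measure.map_map measurable_biShift h1.measurable]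
  exact h5.map_eq

theorem measurePreserving_fst_snd :
    MeasurePreserving (fun q : (X × (ℕ → G)) × (ℕ → G) => (q.1.1, q.2)) (biLaw μ ν η)
      (η.prod (incLaw ν)) :=
  measurePreserving_fst.prod (MeasurePreserving.id (incLaw ν))

theorem measurePreserving_swap_biLaw :
    MeasurePreserving (fun q : (X × (ℕ → G)) × (ℕ → G) => ((q.1.1, q.2), q.1.2)) (biLaw μ ν η)
      (biLaw ν μ η) := by
  have h1 := measurePreserving_prodAssoc η (incLaw μ) (incLaw ν)
  have h2 := (MeasurePreserving.id η).prod
    (Measure.measurePreserving_swap (μ := incLaw μ) (ν := incLaw ν))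
  have h3 := (measurePreserving_prodAssoc η (incLaw ν) (incLaw μ)).symm
  exact h3.comp (h2.comp h1)

/-- The base point together with the points determined by the two halves of the path. -/
def biPoint (m : G → X × (ℕ → G) → M) (m' : G → X × (ℕ → G) → N)
    (q : (X × (ℕ → G)) × (ℕ → G)) : X × M × N :=
  (q.1.1, m 1 q.1, m' 1 (q.1.1, q.2))

theorem measurable_biPoint (hm : IsTrajMap μ η L m) (hm' : IsTrajMap ν η L m') :
    Measurable (biPoint m m') :=
  (measurable_fst.comp measurable_fst).prodMk (((hm.measurable 1).comp measurable_fst).prodMk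
    ((hm'.measurable 1).comp ((measurable_fst.comp measurable_fst).prodMk measurable_snd)))

variable [SMulInvariantMeasure G X η]

/-- On the negative half, shift invariance absorbs the increment put in front into the starting
point, and equivariance turns it into a translation. -/
theorem biPoint_biShift (hm : IsTrajMap μ η L m) (hm' : IsTrajMap ν η L m') :
    ∀ᵐ q ∂(biLaw μ ν η), biPoint m m' (biShift q) = (q.1.2 0)⁻¹ • biPoint m m' q := by
  have h1 := Measure.quasiMeasurePreserving_fst (μ := η.prod (incLaw μ)) (ν := incLaw ν)
    |>.ae hm.ae_step_smul
  have h2 : ∀ᵐ y ∂(η.prod (incLaw ν)), ∀ g : G, m' g (g • y.1, y.2) = g • m' 1 y :=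
    ae_all_iff.2 hm'.equivariant
  have h3 := (measurePreserving_fst_snd (μ := μ) (ν := ν) (η := η)).quasiMeasurePreserving.ae h2
  filter_upwards [h1, h3] with q h4 h5
  refine Prod.ext rfl (Prod.ext h4 ?_)
  change m' 1 ((q.1.2 0)⁻¹ • q.1.1, consSeq (q.1.2 0)⁻¹ q.2) = (q.1.2 0)⁻¹ • m' 1 (q.1.1, q.2)
  rw [hm'.step, one_mul, ← h5]

theorem biPoint_biShift_iterate (hν : ν = μ.inv) (hm : IsTrajMap μ η L m)
    (hm' : IsTrajMap ν η L m') (n : ℕ) :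
    ∀ᵐ q ∂(biLaw μ ν η), biPoint m m' (biShift^[n] q) = (walk q.1.2 n)⁻¹ • biPoint m m' q := by
  induction n with
  | zero => exact Eventually.of_forall fun q => by simp [walk]
  | succ n ih =>
    filter_upwards [biPoint_biShift hm hm',
      (measurePreserving_biShift (η := η) hν).quasiMeasurePreserving.ae ih] with q h1 h2
    rw [Function.iterate_succ_apply, h2, h1, walk_succ', mul_inv_rev, mul_smul]
    rfl

/-- Stationarity: the configuration seen from the position at time n has the law of the
configuration seen from the root. -/
theorem measure_inv_walk_smul_biPoint (hν : ν = μ.inv) (hm : IsTrajMap μ η L m)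
    (hm' : IsTrajMap ν η L m') (n : ℕ) {R : Set (X × M × N)} (hR : MeasurableSet R) :
    biLaw μ ν η {q | (walk q.1.2 n)⁻¹ • biPoint m m' q ∈ R} =
      biLaw μ ν η {q | biPoint m m' q ∈ R} := by
  have h := ((measurePreserving_biShift (η := η) hν).iterate n).measure_preimage
    (s := biPoint m m' ⁻¹' R) ((measurable_biPoint hm hm') hR).nullMeasurableSet
  refine Eq.trans (measure_congr ?_) h
  refine ((biPoint_biShift_iterate hν hm hm' n).mono fun q hq => ?_).set_eq
  change _ ∈ R ↔ biPoint m m' (biShift^[n] q) ∈ R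
  rw [hq]

/-- A property of the bilateral point that holds along the path holds at all group elements. -/
theorem ae_biPoint_of_ae_walk (hμ : Nondegenerate μ) (hm : IsTrajMap μ η L m)
    (hm' : IsTrajMap ν η L m') {V : G → Set (X × M × N)} (hV : ∀ g, MeasurableSet (V g))
    (h : ∀ n, ∀ᵐ q ∂(biLaw μ ν η), biPoint m m' q ∈ V (walk q.1.2 n)) :
    ∀ᵐ q ∂(biLaw μ ν η), ∀ g, biPoint m m' q ∈ V g := by
  have hpm : Measurable fun r : (X × M) × (ℕ → G) => ((r.1.1, r.1.2, m' 1 (r.1.1, r.2)) : X × M × N) :=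
    (measurable_fst.comp measurable_fst).prodMk ((measurable_snd.comp measurable_fst).prodMk
      ((hm'.measurable 1).comp ((measurable_fst.comp measurable_fst).prodMk measurable_snd)))
  have hVm : ∀ g, MeasurableSet {r : (X × M) × (ℕ → G) |
      (r.1.1, r.1.2, m' 1 (r.1.1, r.2)) ∉ V g} := fun g => (hpm (hV g)).compl
  refine ae_all_iff.2 fun g => ?_
  obtain ⟨n, hn⟩ := hμ.exists_stepLaw_ne_zero g
  have hF : ∀ g, Measurable fun w : X × M =>
      incLaw ν {t | (w.1, w.2, m' 1 (w.1, t)) ∉ V g} := fun g =>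
    measurable_measure_prodMk_left (hVm g)
  -- Let F g be the probability, over the independent negative half, of failing at g. Its mean at
  -- the position at time n is zero, so F g vanishes for every g that is reached at time n, under
  -- the law from g and then under the equivalent law from the identity.
  have h0 := hm.lintegral_walk n hF
  have h1 : ∀ᵐ y ∂(η.prod (incLaw μ)),
      incLaw ν {t | (y.1, m 1 y, m' 1 (y.1, t)) ∉ V (walk y.2 n)} = 0 :=
    Measure.ae_ae_of_ae_prod (h n)
  rw [lintegral_congr_ae (g := fun _ => 0) h1, lintegral_zero] at h0
  have h2 := (mul_eq_zero.1 (ENNReal.tsum_eq_zero.1 h0.symm g)).resolve_left hn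
  have h3 := (hm.absolutelyContinuous' hμ g).ae_le ((lintegral_eq_zero_iff (hF g)).1 h2)
  have h4 := hm.ae_of_ae_bundleLaw h3
  have hms : MeasurableSet {q : (X × (ℕ → G)) × (ℕ → G) | biPoint m m' q ∈ V g} :=
    measurable_biPoint hm hm' (hV g)
  exact (Measure.ae_prod_iff_ae_ae hms).2 h4

end Bilateral

section Path

variable {G : Type*} [Group G] [MeasurableSpace G] [Countable G] [DiscreteMeasurableSpace G]
  {X : Type*} [MeasurableSpace X] [MulAction G X] [MeasurableConstSMul G X]
  {μ : Measure G} [IsProbabilityMeasure μ] {η : Measure X} [IsProbabilityMeasure η]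

/-- The bilateral path with given increments of its two halves. -/
def biPath (q : (X × (ℕ → G)) × (ℕ → G)) : X × (ℤ → G) :=
  (q.1.1, glue (walk q.1.2, walk q.2))

theorem measurePreserving_biPath :
    MeasurePreserving biPath (biLaw μ μ.inv η) (η.prod (bilateralLaw μ)) := by
  have h1 : MeasurePreserving (walk : (ℕ → G) → ℕ → G) (incLaw μ) (pathLaw μ) :=
    ⟨measurable_walk, rfl⟩
  have h2 : MeasurePreserving (walk : (ℕ → G) → ℕ → G) (incLaw μ.inv) (pathLaw μ.inv) :=
    ⟨measurable_walk, rfl⟩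
  have h3 : MeasurePreserving (glue : (ℕ → G) × (ℕ → G) → ℤ → G)
      ((pathLaw μ).prod (pathLaw μ.inv)) (bilateralLaw μ) := ⟨measurable_glue, rfl⟩
  exact ((MeasurePreserving.id η).prod (h3.comp (h1.prod h2))).comp
    (measurePreserving_prodAssoc η (incLaw μ) (incLaw μ.inv))

theorem skew_biPath (q : (X × (ℕ → G)) × (ℕ → G)) : skew (biPath q) = biPath (biShift q) := by
  obtain ⟨⟨x, s⟩, t⟩ := q
  have h1 : glue (walk s, walk t) 1 = s 0 := by
    change walk s 1 = s 0
    simp [walk]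
  have h2 : ∀ n : ℤ, (s 0)⁻¹ * glue (walk s, walk t) (n + 1) =
      glue (walk (tailSeq s), walk (consSeq (s 0)⁻¹ t)) n := by
    intro n
    rcases n with n | n
    · change (s 0)⁻¹ * walk s (n + 1) = walk (tailSeq s) n
      rw [walk_succ', inv_mul_cancel_left]
    · change _ = walk (consSeq (s 0)⁻¹ t) (n + 1)
      rw [walk_succ']
      change _ = (s 0)⁻¹ * walk t n
      congr 1
      -- At index -1 the left side reads the positive half at time 0; the two halves agree there,
      -- both being the identity.
      cases n with
      | zero => rfl
      | succ n => rfl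
  refine Prod.ext ?_ (funext fun n => ?_)
  · change (glue (walk s, walk t) 1)⁻¹ • x = (s 0)⁻¹ • x
    rw [h1]
  · change (glue (walk s, walk t) 1)⁻¹ * glue (walk s, walk t) (n + 1) = _
    rw [h1, h2]
    rfl

theorem skew_iterate_biPath (n : ℕ) (q : (X × (ℕ → G)) × (ℕ → G)) :
    skew^[n] (biPath q) = biPath (biShift^[n] q) := by
  induction n generalizing q with
  | zero => rfl
  | succ n ih => rw [Function.iterate_succ_apply, skew_biPath, ih, Function.iterate_succ_apply]

theorem biPath_neg (q : (X × (ℕ → G)) × (ℕ → G)) (n : ℕ) :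
    (biPath q).2 (-(n : ℤ)) = walk q.2 n := by
  cases n with
  | zero => rfl
  | succ n => rfl

theorem zetaPos_biPath {L : X → Subgroup G} {Z M : Type*} (θ : CosetTraj L → Z) (p : Z → M)
    (q : (X × (ℕ → G)) × (ℕ → G)) : zetaPos L θ p (biPath q) = p (trajPoint θ 1 q.1) := by
  rw [trajPoint_one]
  rfl

theorem zetaNeg_biPath {L : X → Subgroup G} {Z M : Type*} (θ : CosetTraj L → Z) (p : Z → M)
    (q : (X × (ℕ → G)) × (ℕ → G)) :
    zetaNeg L θ p (biPath q) = p (trajPoint θ 1 (q.1.1, q.2)) := by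
  rw [trajPoint_one]
  have : negPart (biPath q).2 = walk q.2 := funext fun n => biPath_neg q n
  rw [zetaNeg, this]
  rfl

end Path

/-- The bound ε / 2 on the limsup leaves room for the strict inequality that gives an eventual
bound. -/
theorem eventually_le_exp_of_limsup_log_le {N : ℕ → ℝ≥0∞} {ε : ℝ} (hε : 0 < ε)
    (h : limsup (fun n : ℕ => ENNReal.log (N n) / ((n : ℝ) : EReal)) atTop ≤ ((ε / 2 : ℝ) : EReal)) :
    ∀ᶠ n : ℕ in atTop, N n ≤ ENNReal.ofReal (Real.exp (ε * n)) := by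
  have hlt : limsup (fun n : ℕ => ENNReal.log (N n) / ((n : ℝ) : EReal)) atTop < (ε : EReal) :=
    h.trans_lt (by exact_mod_cast half_lt_self hε)
  filter_upwards [eventually_lt_of_limsup_lt hlt, eventually_gt_atTop 0] with n hn hn0
  have hn0' : (0 : EReal) < ((n : ℝ) : EReal) := by exact_mod_cast hn0
  rw [EReal.div_lt_iff hn0' (EReal.coe_ne_top _), ← EReal.coe_mul] at hn
  have h1 : N n ≤ EReal.exp ((ε * n : ℝ) : EReal) := by
    rw [← ENNReal.exp_log (N n)]
    exact EReal.exp_monotone hn.le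
  rwa [EReal.exp_coe] at h1

end PoissonBundle

/-! ### Compatible bilateral strips and the theorem -/

namespace PoissonBundle

open scoped ENNReal

section BilateralStrip

variable {G : Type*} [Group G] [MeasurableSpace G] [Countable G] [DiscreteMeasurableSpace G]
  {X : Type*} [MeasurableSpace X] [MulAction G X] [MeasurableConstSMul G X]
  {M : Type*} [MeasurableSpace M] [MulAction G M] [MeasurableConstSMul G M]
  {N : Type*} [MeasurableSpace N] [MulAction G N] [MeasurableConstSMul G N]
  {μ ν : Measure G} [IsProbabilityMeasure μ] [IsProbabilityMeasure ν]
  {η : Measure X} [IsProbabilityMeasure η] {L : X → Subgroup G}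

/-- The triples `(x, m, m')` whose strip contains the coset of `g`. -/
def stripSet (S : (x : X) → M → N → Set (CosetSpace (L x))) (g : G) : Set (X × M × N) :=
  {v | coset (L v.1) g ∈ S v.1 v.2.1 v.2.2}

/-- Bilateral strips that are compatible with the action, contain the root with positive
probability and have subexponential size along the path yield an isomorphism. -/
theorem IsIntermediate.isIsomorphism_of_bilateral_strip [MetricSpace G]
    {Z : Type*} [MeasurableSpace Z] [MulAction G Z] [MeasurableConstSMul G Z]
    [StandardBorelSpace Z] [StandardBorelSpace M] [ErgodicSMul G X η]
    (hν : ν = μ.inv) (hμ : Nondegenerate μ) (hent : FiniteEntropy μ)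
    (hL : ∀ g : G, MeasurableSet {x : X | g ∈ L x})
    {lam : Measure Z} {θ : CosetTraj L → Z} {κ : Measure M} {p : Z → M} {q : M → X}
    (hZ : IsPoissonBundle μ η L lam θ) (hM : IsIntermediate μ η L lam θ κ p q)
    {m' : G → X × (ℕ → G) → N} (hm' : IsTrajMap ν η L m')
    {S : (x : X) → M → N → Set (CosetSpace (L x))}
    (hS : ∀ g : G, MeasurableSet (stripSet S g))
    (hcompat : ∀ᵐ r ∂(biLaw μ ν η), ∀ g : G,
      (biPoint (fun g y => p (trajPoint θ g y)) m' r ∈ stripSet S g ↔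
        g⁻¹ • biPoint (fun g y => p (trajPoint θ g y)) m' r ∈ stripSet S 1))
    (hroot : biLaw μ ν η
      {r | biPoint (fun g y => p (trajPoint θ g y)) m' r ∈ stripSet S 1} ≠ 0)
    (hgrowth : ∀ ε : ℝ, 0 < ε → ∀ᵐ r ∂(biLaw μ ν η), ∀ᶠ n : ℕ in atTop,
      ((S r.1.1 (p (trajPoint θ 1 r.1)) (m' 1 (r.1.1, r.2)) ∩
        cosetBall (L r.1.1) (cosetLength (L r.1.1)
          (coset (L r.1.1) (walk r.1.2 n)))).encard : ℝ≥0∞) ≤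
        ENNReal.ofReal (Real.exp (ε * n))) :
    IsIsomorphism G p lam κ := by
  have hm := hM.isTrajMap hZ
  refine hM.isIsomorphism_of_strip hμ hent hL hZ (τ := incLaw ν)
    (strip := fun w t => S w.1 w.2 (m' 1 (w.1, t))) (fun g => ?_) hroot (fun n => ?_) hgrowth
  · exact ((measurable_fst.comp measurable_fst).prodMk ((measurable_snd.comp measurable_fst).prodMk
      ((hm'.measurable 1).comp ((measurable_fst.comp measurable_fst).prodMk measurable_snd))))
      (hS g)
  -- The lower bound is the probability of containing the root. It equals the probability of this
  -- event seen from time n, which by compatibility forces the coset of the walk into the strip.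
  · rw [← measure_inv_walk_smul_biPoint hν hm hm' n (hS 1)]
    refine measure_mono_ae (hcompat.mono fun r hr h => ?_)
    exact (hr (walk r.1.2 n)).2 h

theorem measurable_zetaPos {Z : Type*} [MeasurableSpace Z] {θ : CosetTraj L → Z} {p : Z → M}
    (hθ : Measurable θ) (hp : Measurable p) : Measurable (zetaPos L θ p) :=
  hp.comp (hθ.comp ((measurable_toCosetTraj L).comp (measurable_fst.prodMk
    (measurable_pi_lambda _ fun n : ℕ => (measurable_pi_apply (n : ℤ)).comp measurable_snd))))

theorem measurable_zetaNeg {Z : Type*} [MeasurableSpace Z] {θ : CosetTraj L → Z} {p : Z → M}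
    (hθ : Measurable θ) (hp : Measurable p) : Measurable (zetaNeg L θ p) :=
  hp.comp (hθ.comp ((measurable_toCosetTraj L).comp (measurable_fst.prodMk
    (measurable_pi_lambda _ fun n : ℕ => (measurable_pi_apply (-(n : ℤ))).comp measurable_snd))))

end BilateralStrip

end PoissonBundle

theorem mainTheorem10
    {G : Type*} [Group G] [Countable G] [MeasurableSpace G] [DiscreteMeasurableSpace G]
    [MetricSpace G]
    (μ : Measure G) [IsProbabilityMeasure μ] (hμ : FiniteEntropy μ) (hμ' : Nondegenerate μ)
    {X : Type*} [MeasurableSpace X] [StandardBorelSpace X] [MulAction G X]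
    [MeasurableConstSMul G X]
    (η : Measure X) [IsProbabilityMeasure η] [ErgodicSMul G X η]
    (L : X → Subgroup G) (hL : IsSubgroupMap L)
    -- the Poisson bundles in positive and negative time
    {Zp Zm : Type*}
    [MeasurableSpace Zp] [StandardBorelSpace Zp] [MulAction G Zp] [MeasurableConstSMul G Zp]
    [MeasurableSpace Zm] [StandardBorelSpace Zm] [MulAction G Zm] [MeasurableConstSMul G Zm]
    (lamp : Measure Zp) (θp : CosetTraj L → Zp) (hZp : IsPoissonBundle μ η L lamp θp)
    (lamm : Measure Zm) (θm : CosetTraj L → Zm) (hZm : IsPoissonBundle μ.inv η L lamm θm)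
    -- the candidates
    {Mp Mm : Type*}
    [MeasurableSpace Mp] [StandardBorelSpace Mp] [MulAction G Mp] [MeasurableConstSMul G Mp]
    [MeasurableSpace Mm] [StandardBorelSpace Mm] [MulAction G Mm] [MeasurableConstSMul G Mm]
    (κp : Measure Mp) (pp : Zp → Mp) (qp : Mp → X)
    (hMp : IsIntermediate μ η L lamp θp κp pp qp)
    (κm : Measure Mm) (pm : Zm → Mm) (qm : Mm → X)
    (hMm : IsIntermediate μ.inv η L lamm θm κm pm qm)
    -- the strips
    (S : (x : X) → Mp → Mm → Set (CosetSpace (L x)))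
    (hS : ∀ g : G, MeasurableSet {t : X × Mp × Mm | coset (L t.1) g ∈ S t.1 t.2.1 t.2.2})
    (strip : (y : X × (ℤ → G)) → Set (CosetSpace (L y.1)))
    (hstrip : strip = stripAt S (zetaPos L θp pp) (zetaNeg L θm pm))
    -- compatibility
    (h_compat : ∀ n : ℕ, ∀ᵐ y ∂(η.prod (bilateralLaw μ)),
      (coset (L y.1) (y.2 n) ∈ strip y ↔
        coset (L (skew^[n] y).1) 1 ∈ strip (skew^[n] y)))
    -- positive probability of containing the root
    (h_root : 0 < (η.prod (bilateralLaw μ)) {y | coset (L y.1) 1 ∈ strip y}) :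
    -- subexponential size along the path in positive time, respectively in negative time
    ((∀ ε : ℝ, 0 < ε → ∀ᵐ y ∂(η.prod (bilateralLaw μ)),
        limsup (fun n : ℕ => stripGrowth y.1 (strip y) (y.2 n) n) atTop ≤ (ε : EReal)) →
      IsIsomorphism G pp lamp κp) ∧
    ((∀ ε : ℝ, 0 < ε → ∀ᵐ y ∂(η.prod (bilateralLaw μ)),
        limsup (fun n : ℕ => stripGrowth y.1 (strip y) (y.2 (-(n : ℤ))) n) atTop ≤ (ε : EReal)) →
      IsIsomorphism G pm lamm κm) := by
  subst hstrip
  have hmp := hMp.isTrajMap hZp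
  have hmm := hMm.isTrajMap hZm
  set mp : G → X × (ℕ → G) → Mp := fun g y => pp (trajPoint θp g y) with hmp_def
  set mm : G → X × (ℕ → G) → Mm := fun g y => pm (trajPoint θm g y) with hmm_def
  have hB : MeasurePreserving biPath (biLaw μ μ.inv η) (η.prod (bilateralLaw μ)) :=
    measurePreserving_biPath
  have hR : ∀ g : G, MeasurableSet (stripSet S g) := hS
  have hmem : ∀ (r : (X × (ℕ → G)) × (ℕ → G)) (g : G),
      coset (L (biPath r).1) g ∈ stripAt S (zetaPos L θp pp) (zetaNeg L θm pm) (biPath r) ↔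
        biPoint mp mm r ∈ stripSet S g := by
    intro r g
    rw [stripAt, zetaPos_biPath, zetaNeg_biPath]
    rfl
  have hwalk : ∀ n : ℕ, ∀ᵐ r ∂(biLaw μ μ.inv η),
      (biPoint mp mm r ∈ stripSet S (walk r.1.2 n) ↔
        (walk r.1.2 n)⁻¹ • biPoint mp mm r ∈ stripSet S 1) := by
    intro n
    filter_upwards [hB.quasiMeasurePreserving.ae (h_compat n),
      biPoint_biShift_iterate rfl hmp hmm n] with r h1 h2
    rw [skew_iterate_biPath, hmem, hmem, h2] at h1
    exact h1
  -- Compatibility at all group elements no longer refers to a direction of time, so it can also be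
  -- used along the negative half.
  have hall : ∀ᵐ r ∂(biLaw μ μ.inv η), ∀ g : G,
      (biPoint mp mm r ∈ stripSet S g ↔ g⁻¹ • biPoint mp mm r ∈ stripSet S 1) :=
    ae_biPoint_of_ae_walk hμ' hmp hmm
      (V := fun g => {v | v ∈ stripSet S g ↔ g⁻¹ • v ∈ stripSet S 1})
      (fun g => (hR g).iff ((measurable_const_smul g⁻¹) (hR 1))) hwalk
  have hroot : biLaw μ μ.inv η {r | biPoint mp mm r ∈ stripSet S 1} ≠ 0 := by
    have hpos : Measurable (zetaPos L θp pp) :=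
      measurable_zetaPos hZp.measurable hMp.factor_left.measurePreserving.measurable
    have hneg : Measurable (zetaNeg L θm pm) :=
      measurable_zetaNeg hZm.measurable hMm.factor_left.measurePreserving.measurable
    have h := hB.measure_preimage
      (measurable_fst.prodMk (hpos.prodMk hneg) (hR 1)).nullMeasurableSet
    refine ne_of_gt (h_root.trans_eq (h.symm.trans ?_))
    exact congrArg _ (Set.ext fun r => hmem r 1)
  constructor
  · intro hpos
    refine hMp.isIsomorphism_of_bilateral_strip rfl hμ' hμ hL.measurable hZp hmm hR hall hroot
      fun ε hε => ?_
    filter_upwards [hB.quasiMeasurePreserving.ae (hpos (ε / 2) (half_pos hε))] with r hr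
    refine eventually_le_exp_of_limsup_log_le hε ?_
    simp only [stripGrowth, stripAt, zetaPos_biPath, zetaNeg_biPath] at hr
    exact hr
  · intro hneg
    -- Exchanging the halves makes the walk with steps `μ.inv` the positive one; its reflection is μ
    -- again, and the strip takes its two arguments in the opposite order.
    have hsw := measurePreserving_swap_biLaw (μ := μ.inv) (ν := μ) (η := η)
    have hsw' : Measurable fun v : X × Mm × Mp => ((v.1, v.2.2, v.2.1) : X × Mp × Mm) := by
      fun_prop
    refine hMm.isIsomorphism_of_bilateral_strip (ν := μ) (S := fun x a b => S x b a)
      (inv_inv_measure μ).symm hμ'.inv hμ.inv hL.measurable hZm hmp (fun g => hsw' (hR g))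
      (hsw.quasiMeasurePreserving.ae hall) ?_ fun ε hε => ?_
    · have h := hsw.measure_preimage (s := biPoint mp mm ⁻¹' stripSet S 1)
        (measurable_biPoint hmp hmm (hR 1)).nullMeasurableSet
      exact fun h0 => hroot (h.symm.trans h0)
    filter_upwards [hsw.quasiMeasurePreserving.ae
      (hB.quasiMeasurePreserving.ae (hneg (ε / 2) (half_pos hε)))] with r hr
    refine eventually_le_exp_of_limsup_log_le hε ?_
    simp only [stripGrowth, stripAt, zetaPos_biPath, zetaNeg_biPath, biPath_neg] at hr
    exact hr
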